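/- **Setting.** Let $K\ge 2$ and $n$ be integers. A clustering of $n$ nodes into $K$ communities is a matrix $Z\in\{0,1\}^{n\times K}$ with exactly one $1$ in each row; $\mathcal M_{n,K}$ is the set of all of them, $\mathcal N_k$ is the set of nodes $i$ with $Z_{i,k}=1$, and $n_k=|\mathcal N_k|$. For $B\in\mathbb R^{n\times n}$, $B^{(k,l)}(Z)$ denotes the submatrix of $B$ with rows in $\mathcal N_k$ and columns in $\mathcal N_l$. A sparsity set is a set $J\subseteq\{1,\dots,n\}\times\{1,\dots,K\}$; given $Z$, put $J_{k,l}=\{i\in\mathcal N_k:(i,l)\in J\}$, so that $|J|=\sum_{k,l}|J_{k,l}|$, and $J^{(k,l)}=J_{k,l}\times J_{l,k}$. $\Pi_{J^{(k,l)}}$ sets to zero the entries outside $J^{(k,l)}$, and $\Pi_{(1)}(X)$ is a best approximation of $X$ in Frobenius norm by matrices of rank at most one. **Model.** Let $Z_*\in\mathcal M_{n,K}$ be the true clustering with assignment $c$ ($c(i)=k$ iff $(Z_*)_{i,k}=1$), let $\Lambda\in[0,1]^{n\times K}$ and $(P_*)_{i,j}=\Lambda_{i,c(j)}\Lambda_{j,c(i)}$;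 that is, $P_*^{(k,l)}(Z_*)=\Lambda^{(k,l)}[\Lambda^{(l,k)}]^T$, where $\Lambda^{(k,l)}\in[0,1]^{n_k}$ is the part of column $l$ of $\Lambda$ with rows in the $k$-th true community. Assume (A1): for each $k$ the vectors $\Lambda^{(k,1)},\dots,\Lambda^{(k,K)}$ are linearly independent. Let $J_*=\{(i,l):\Lambda_{i,l}\ne0\}$ and, for $Z\in\mathcal M_{n,K}$, let $\breve J_*(Z)$ be the sparsity set whose part $(\breve J_*)_{k,l}$ is the set of nonzero rows of $P_*^{(k,l)}(Z)$. The adjacency matrix $A\in\{0,1\}^{n\times n}$ is random and symmetric, its entries $A_{i,j}$, $i\le j$, are independent, and $A_{i,j}\sim\mathrm{Bernoulli}((P_*)_{i,j})$. (The result is claimed both if this holds for all $i\le j$, and if it holds for $i<j$ while $A_{i,i}=0$ for all $i$.) **Estimator.** Let $\beta_1,\beta_2>0$ be constants and let $\mathrm{Pen}$ be the separable penalty $$\beta_1\sum_{k,l=1}^K|J_{k,l}|\ln\frac{n_ke}{|J_{k,l}|}+\beta_2K\sum_{k=1}^K\ln n_k+\beta_2[n\ln K+\ln n]$$ or the non-separable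 penalty $$\beta_1|J|\ln\frac{nKe}{|J|}+2\beta_2\ln n+\beta_2[n\ln K+\ln n]$$ (with $0\ln(\cdot/0)=0$, and a community with $n_k=0$ contributing nothing to $\sum_k\ln n_k$). Let $(\hat Z,\hat J)$ minimize $$\sum_{k,l=1}^K\big\|A^{(k,l)}(Z)-\Pi_{(1)}\big(\Pi_{J^{(k,l)}}(A^{(k,l)}(Z))\big)\big\|_F^2+\mathrm{Pen}$$ over all $Z\in\mathcal M_{n,K}$ and all sparsity sets $J$. The proportion of nodes misclassified by $Z$ is $\mathrm{Err}(Z,Z_*)=(2n)^{-1}\min_{Q}\|ZQ-Z_*\|_1$, with $Q$ ranging over the $K\times K$ permutation matrices and $\|\cdot\|_1$ the sum of the absolute values of the entries, and $\Upsilon(Z_*,\delta)=\{Z\in\mathcal M_{n,K}:\mathrm{Err}(Z,Z_*)\ge\delta\}$. **Theorem 2.** For all $\beta_1,\beta_2>0$ there are constants $H_1,H_2>0$, depending only on $\beta_1,\beta_2$ (in particular not on $n$, $K$, $Z_*$, $\Lambda$, $J_*$, $\breve J_*(Z)$, $\alpha_n$, $\delta_n$, $t$), such that the following holds in the above setting.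 If for some $\alpha_n\in(0,1/2)$, $\delta_n\in(0,1)$ and $t>0$ $$\|P_*\|_F^2\ \ge\ \max_{Z\in\Upsilon(Z_*,\delta_n)}\Big[(1+\alpha_n)\sum_{k,l=1}^K\|P_*^{(k,l)}(Z)\|_{op}^2+\frac{H_1}{\alpha_n}|\breve J_*(Z)|\ln\frac{nKe}{|\breve J_*(Z)|}\Big]+\frac{H_1}{\alpha_n}\big(|J_*|+n\ln K+t\big)+H_2|J_*|\ln\frac{nKe}{|J_*|}$$ (a condition regarded as satisfied if $\Upsilon(Z_*,\delta_n)=\emptyset$), then with probability at least $1-2e^{-t}$ the proportion of nodes misclassified by $\hat Z$ is at most $\delta_n$, for every solution $(\hat Z,\hat J)$ of the minimization problem. -/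

import Mathlib

open MeasureTheory ProbabilityTheory

noncomputable section

namespace PABM

/-! ### Matrix norms, projections and rank one approximation -/

/-- The squared Frobenius norm of a real matrix. -/
def frobSq {m n : Type*} [Fintype m] [Fintype n] (X : Matrix m n ℝ) : ℝ :=
  ∑ i, ∑ j, X i j ^ 2

/-- The entrywise `ℓ₁` norm of a real matrix. -/
def l1Norm {m n : Type*} [Fintype m] [Fintype n] (X : Matrix m n ℝ) : ℝ :=
  ∑ i, ∑ j, |X i j|

/-- The spectral norm: the operator norm of `X` between Euclidean spaces. -/
def opNorm {m n : Type*} [Fintype m] [Fintype n] [DecidableEq n] (X : Matrix m n ℝ) : ℝ :=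
  ‖LinearMap.toContinuousLinearMap (Matrix.toEuclideanLin X)‖

/-- The projection of `X` onto the matrices supported on the rectangle `S × T`. -/
def rectProj {m n : Type*} [DecidableEq m] [DecidableEq n] (S : Finset m) (T : Finset n)
    (X : Matrix m n ℝ) : Matrix m n ℝ :=
  Matrix.of fun i j => if i ∈ S ∧ j ∈ T then X i j else 0

/-- `Y` is a best approximation of `X`, in Frobenius norm, by matrices of rank at most one. -/
def IsBestRankOne {m n : Type*} [Fintype m] [Fintype n] (X Y : Matrix m n ℝ) : Prop :=
  Y.rank ≤ 1 ∧ ∀ M : Matrix m n ℝ, M.rank ≤ 1 → frobSq (X - Y) ≤ frobSq (X - M)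

theorem rank_le_one_iff_minors {m n : Type*} [Fintype m] [Fintype n] (M : Matrix m n ℝ) :
    M.rank ≤ 1 ↔ ∀ i i' j j', M i j * M i' j' = M i j' * M i' j := by
  classical
  constructor
  · intro h i i' j j'
    obtain ⟨v, hv⟩ := finrank_le_one_iff.mp h
    have key : ∀ j, ∃ a : ℝ, ∀ i, M i j = a * v.1 i := by
      intro j
      obtain ⟨a, ha⟩ := hv ⟨M.mulVecLin (Pi.single j 1), ⟨_, rfl⟩⟩
      refine ⟨a, fun i => ?_⟩
      have := congrFun (congrArg Subtype.val ha) i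
      simp at this
      exact this.symm
    obtain ⟨a, ha⟩ := key j
    obtain ⟨b, hb⟩ := key j'
    rw [ha, hb, ha, hb]; ring
  · intro h
    by_cases h0 : M = 0
    · subst h0; simp
    · have : ∃ i j, M i j ≠ 0 := by
        by_contra! hc
        exact h0 (Matrix.ext hc)
      obtain ⟨i, j, hij⟩ := this
      have : M = Matrix.vecMulVec (fun i' => M i' j / M i j) (M i) := by
        ext i' j'
        rw [Matrix.vecMulVec_apply]
        field_simp
        rw [h i' i j' j]
      rw [this]
      exact Matrix.rank_vecMulVec_le _ _

theorem exists_isBestRankOne {m n : Type*} [Fintype m] [Fintype n] (X : Matrix m n ℝ) :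
    ∃ Y, IsBestRankOne X Y := by
  have hcont : Continuous fun M : Matrix m n ℝ => frobSq (X - M) := by
    unfold frobSq
    simp only [Matrix.sub_apply]
    fun_prop
  have hcl : IsClosed {M : Matrix m n ℝ | M.rank ≤ 1} := by
    simp only [rank_le_one_iff_minors, Set.ofPred_forall]
    refine isClosed_iInter fun i => isClosed_iInter fun i' => isClosed_iInter fun j =>
      isClosed_iInter fun j' => isClosed_eq ?_ ?_ <;> fun_prop
  have hbox : IsCompact {M : Matrix m n ℝ | ∀ i j,
      M i j ∈ Set.Icc (X i j - √(frobSq X)) (X i j + √(frobSq X))} := by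
    have := isCompact_univ_pi fun i : m => isCompact_univ_pi fun j : n =>
      (isCompact_Icc : IsCompact (Set.Icc (X i j - √(frobSq X)) (X i j + √(frobSq X))))
    have hEq : {M : Matrix m n ℝ | ∀ i j,
        M i j ∈ Set.Icc (X i j - √(frobSq X)) (X i j + √(frobSq X))} =
        Set.pi Set.univ fun i : m => Set.pi Set.univ fun j : n =>
          Set.Icc (X i j - √(frobSq X)) (X i j + √(frobSq X)) := by
      apply Set.ext
      intro M
      exact ⟨fun h i _ j _ => h i j, fun h i j => h i trivial j trivial⟩
    rw [hEq]
    exact this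
  have h0 : (0 : Matrix m n ℝ).rank ≤ 1 := by simp
  have hentry : ∀ (M : Matrix m n ℝ) i j, |M i j| ≤ √(frobSq M) := by
    intro M i j
    apply Real.abs_le_sqrt
    calc M i j ^ 2 ≤ ∑ j, M i j ^ 2 :=
          Finset.single_le_sum (f := fun j => M i j ^ 2) (fun _ _ => sq_nonneg _)
            (Finset.mem_univ j)
      _ ≤ frobSq M :=
          Finset.single_le_sum (f := fun i => ∑ j, M i j ^ 2)
            (fun _ _ => Finset.sum_nonneg fun _ _ => sq_nonneg _) (Finset.mem_univ i)
  have hmem : ∀ M : Matrix m n ℝ, frobSq (X - M) ≤ frobSq X →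
      M ∈ {M : Matrix m n ℝ | ∀ i j,
        M i j ∈ Set.Icc (X i j - √(frobSq X)) (X i j + √(frobSq X))} := by
    intro M hM i j
    have h1 := (hentry (X - M) i j).trans (Real.sqrt_le_sqrt hM)
    rw [Matrix.sub_apply, abs_le] at h1
    constructor <;> linarith [h1.1, h1.2]
  obtain ⟨Y, hY, hmin⟩ := (hbox.inter_right hcl).exists_isMinOn
    ⟨0, hmem 0 (by simp), h0⟩ hcont.continuousOn
  refine ⟨Y, hY.2, fun M hM => ?_⟩
  by_cases hle : frobSq (X - M) ≤ frobSq X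
  · exact hmin ⟨hmem M hle, hM⟩
  · have h2 : frobSq (X - Y) ≤ frobSq (X - 0) := hmin ⟨hmem 0 (by simp), h0⟩
    rw [sub_zero] at h2
    linarith

/-- The best rank one approximation of `X`. (If it is not unique, one is chosen; the residual
`frobSq (X - rankOneApprox X)` does not depend on the choice.) -/
def rankOneApprox {m n : Type*} [Fintype m] [Fintype n] (X : Matrix m n ℝ) : Matrix m n ℝ :=
  (exists_isBestRankOne X).choose

theorem rankOneApprox_spec {m n : Type*} [Fintype m] [Fintype n] (X : Matrix m n ℝ) :
    IsBestRankOne X (rankOneApprox X) :=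
  (exists_isBestRankOne X).choose_spec

/-! ### Clusterings, blocks and sparsity sets -/

/-- A clustering of `n` nodes into `K` communities: the vector of community assignments. -/
abbrev Clustering (n K : ℕ) : Type := Fin n → Fin K

/-- The clustering matrix in `{0,1}^{n × K}`: entry `(i, k)` is one iff node `i` is in
community `k`. -/
def clusteringMatrix {n K : ℕ} (Z : Clustering n K) : Matrix (Fin n) (Fin K) ℝ :=
  Matrix.of fun i k => if Z i = k then 1 else 0

/-- The set of nodes of community `k`. -/
abbrev Community {n K : ℕ} (Z : Clustering n K) (k : Fin K) : Type := {i : Fin n // Z i = k}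

/-- The size `n_k` of community `k`. -/
def commSize {n K : ℕ} (Z : Clustering n K) (k : Fin K) : ℕ := Fintype.card (Community Z k)

/-- The `(k, l)` block of `B` under the clustering `Z`: rows in community `k`, columns in
community `l`. -/
def block {n K : ℕ} (Z : Clustering n K) (B : Matrix (Fin n) (Fin n) ℝ) (k l : Fin K) :
    Matrix (Community Z k) (Community Z l) ℝ :=
  B.submatrix Subtype.val Subtype.val

/-- A sparsity set is a set `J` of positions of an `n × K` matrix. Its part `J_{k,l}` consists
of the nodes `i` of community `k` with `(i, l) ∈ J`; thus `J` is the disjoint union of the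
`J_{k,l}`. -/
def part {n K : ℕ} (Z : Clustering n K) (J : Finset (Fin n × Fin K)) (k l : Fin K) :
    Finset (Community Z k) :=
  Finset.univ.filter fun i => (i.1, l) ∈ J

/-- The proportion of nodes misclustered by `Z`, up to relabeling of the communities. -/
def misclustered {n K : ℕ} (Z Zstar : Clustering n K) : ℝ :=
  (2 * (n : ℝ))⁻¹ * ⨅ σ : Equiv.Perm (Fin K),
    l1Norm (clusteringMatrix Z * σ.permMatrix ℝ - clusteringMatrix Zstar)

/-- The clusterings whose proportion of misclustered nodes is at least `δ`. -/
def farClusterings {n K : ℕ} (Zstar : Clustering n K) (δ : ℝ) : Set (Clustering n K) :=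
  {Z | δ ≤ misclustered Z Zstar}

/-! ### The popularity adjusted block model -/

/-- The matrix of connection probabilities: the entry for `i` in community `k` and `j` in
community `l` is `Λ^{(k,l)}_i Λ^{(l,k)}_j`, where `Λ i l` is the popularity of node `i` with
respect to community `l`. -/
def probMatrix {n K : ℕ} (Z : Clustering n K) (L : Matrix (Fin n) (Fin K) ℝ) :
    Matrix (Fin n) (Fin n) ℝ :=
  Matrix.of fun i j => L i (Z j) * L j (Z i)

/-- For every community `k`, the vectors `Λ^{(k,1)}, …, Λ^{(k,K)}` are linearly independent. -/
def LinIndepPopularities {n K : ℕ} (Z : Clustering n K) (L : Matrix (Fin n) (Fin K) ℝ) : Prop :=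
  ∀ k : Fin K, LinearIndependent ℝ fun (l : Fin K) (i : Community Z k) => L i.1 l

open Classical in
/-- The set of positions of the nonzero elements of `Λ`. -/
def supportSet {n K : ℕ} (L : Matrix (Fin n) (Fin K) ℝ) : Finset (Fin n × Fin K) :=
  Finset.univ.filter fun p => L p.1 p.2 ≠ 0

open Classical in
/-- The sparsity set of `P` under an arbitrary clustering `Z`: its `(k, l)` part consists of the
nonzero rows of the block `P^{(k,l)}(Z)`. -/
def blockSupport {n K : ℕ} (Z : Clustering n K) (P : Matrix (Fin n) (Fin n) ℝ) :
    Finset (Fin n × Fin K) :=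
  Finset.univ.filter fun p => ∃ j, Z j = p.2 ∧ P p.1 j ≠ 0

/-- `A` is a random symmetric `{0,1}` matrix whose entries on and above the diagonal are
independent and Bernoulli with means given by `P`. For the diagonal there are two conventions:
its entries are Bernoulli with means given by `P` like all the others, or there are no
self-loops at all. -/
structure IsRandomAdjacency {n : ℕ} {Ω : Type*} [MeasurableSpace Ω] (μ : Measure Ω)
    (A : Ω → Matrix (Fin n) (Fin n) ℝ) (P : Matrix (Fin n) (Fin n) ℝ) : Prop where
  measurable : ∀ i j, Measurable fun ω => A ω i j
  zero_or_one : ∀ ω i j, A ω i j = 0 ∨ A ω i j = 1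
  symm : ∀ ω i j, A ω i j = A ω j i
  indep : iIndepFun (fun (p : {p : Fin n × Fin n // p.1 ≤ p.2}) ω => A ω p.1.1 p.1.2) μ
  prob : ∀ i j, i < j → μ.real {ω | A ω i j = 1} = P i j
  diag : (∀ i, μ.real {ω | A ω i i = 1} = P i i) ∨ (∀ ω i, A ω i i = 0)

/-! ### The penalized estimator -/

/-- `x ln (N e / x)`, with value `0` at `x = 0`. -/
def entropyTerm (N x : ℕ) : ℝ := (x : ℝ) * Real.log (N * Real.exp 1 / x)

/-- The part of the penalties that does not depend on the sparsity set. -/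
def penBase (β₂ : ℝ) (n K : ℕ) : ℝ := β₂ * (n * Real.log K + Real.log n)

/-- The separable penalty; an empty community contributes `0` to the sum of the `ln n_k`. -/
def sepPenalty (β₁ β₂ : ℝ) {n K : ℕ} (Z : Clustering n K) (J : Finset (Fin n × Fin K)) : ℝ :=
  β₁ * ∑ k, ∑ l, entropyTerm (commSize Z k) (part Z J k l).card
    + β₂ * K * ∑ k, Real.log (commSize Z k) + penBase β₂ n K

/-- The non-separable penalty. -/
def nonsepPenalty (β₁ β₂ : ℝ) {n K : ℕ} (_Z : Clustering n K) (J : Finset (Fin n × Fin K)) : ℝ :=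
  β₁ * entropyTerm (n * K) J.card + 2 * β₂ * Real.log n + penBase β₂ n K

/-- The penalized criterion: the squared distance of every block of `A` to the best rank one
approximation of its restriction to `J_{k,l} × J_{l,k}`, plus the penalty. -/
def criterion {n K : ℕ} (pen : Clustering n K → Finset (Fin n × Fin K) → ℝ)
    (A : Matrix (Fin n) (Fin n) ℝ) (Z : Clustering n K) (J : Finset (Fin n × Fin K)) : ℝ :=
  ∑ k, ∑ l, frobSq (block Z A k l -
      rankOneApprox (rectProj (part Z J k l) (part Z J l k) (block Z A k l)))
    + pen Z J

/-- `(Z, J)` minimizes the penalized criterion over all clusterings and sparsity sets. -/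
def IsSolution {n K : ℕ} (pen : Clustering n K → Finset (Fin n × Fin K) → ℝ)
    (A : Matrix (Fin n) (Fin n) ℝ) (Z : Clustering n K) (J : Finset (Fin n × Fin K)) : Prop :=
  ∀ Z' J', criterion pen A Z J ≤ criterion pen A Z' J'

/-- The lower bound required of the squared Frobenius norm of the probability matrix, uniformly
over all clusterings with a proportion of misclustered nodes of at least `δ`. -/
def SeparationCondition (H₁ H₂ α δ t : ℝ) {n K : ℕ} (Zstar : Clustering n K)
    (L : Matrix (Fin n) (Fin K) ℝ) : Prop :=
  ∀ Z ∈ farClusterings Zstar δ,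
    ((1 + α) * ∑ k, ∑ l, opNorm (block Z (probMatrix Zstar L) k l) ^ 2
        + H₁ / α * entropyTerm (n * K) (blockSupport Z (probMatrix Zstar L)).card)
      + H₁ / α * ((supportSet L).card + n * Real.log K + t)
      + H₂ * entropyTerm (n * K) (supportSet L).card
    ≤ frobSq (probMatrix Zstar L)

end PABM

end

/-! The criterion at $(\hat Z,\hat J)$ is compared with its value at $(Z_*,J_*)$. A block's residual
after any matrix of rank at most one is at least $\|X\|_F^2-\|X\|_{op}^2$, so $\hat J$ can be
dropped from the lower bound, `frobSq_sub_opSq_add_le_criterion`. At the truth the blocks of $P_*$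
are competitors of rank at most one (`criterion_le`). Cancelling $\|A\|_F^2$ and the common part of
the penalties leaves $2\langle A,P_*\rangle-\|P_*\|_F^2\le\sum_{k,l}\|A^{(k,l)}(\hat
Z)\|_{op}^2+(\beta_1+2\beta_2)|J_*|\ln(nKe/|J_*|)$.

With $m=\mathbb E A$, the left side is $\|P_*\|_F^2$ up to one linear noise term and a diagonal bias
of order $|J_*|$. On the right, $A=P_*+(A-m)+(m-P_*)$ gives $(1+\alpha/4)$ times the operator sum of
$P_*$ plus $O(1/\alpha)$ times the noise. If $\hat Z$ were too far from $Z_*$, the separation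
condition would contradict this (`separation_contradiction`).

The noise must be controlled uniformly in $\hat Z$. Almost surely $A$ vanishes where $P_*$ does, so
for each $Z$ the noise lives on $\breve J_*(Z)$ and no union over sparsity sets is needed. The root
of the sum of squared block operator norms is a supremum of a form bilinear in two vectors supported
on $\breve J_*(Z)$; nets reduce it to at most $25^{|\breve J_*(Z)|}$ test matrices
(`exists_test_matrices`). A sub-Gaussian tail and a union bound over these and the $K^n$ clusterings
finish the argument (`IsRandomAdjacency.union_tail`). -/

noncomputable section

namespace PABM

/-! ### Nets of unit balls -/

/-- The unit ball of a finite-dimensional normed space has a `1/2`-net of at most `5 ^ dim`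
points. -/
theorem exists_half_net (E : Type*) [NormedAddCommGroup E] [NormedSpace ℝ E]
    [FiniteDimensional ℝ E] :
    ∃ N : Finset E, N.card ≤ 5 ^ Module.finrank ℝ E ∧ (∀ x ∈ N, ‖x‖ ≤ 1) ∧
      ∀ x : E, ‖x‖ ≤ 1 → ∃ y ∈ N, ‖x - y‖ ≤ 1 / 2 := by
  classical
  -- A 1-separated set of largest cardinality in the ball of radius 2 is a 1-net of it; halving it
  -- gives the required net. The packing bound $5^{\dim}$ guarantees that a largest one exists.
  let good : Finset E → Prop := fun s =>
    (∀ c ∈ s, ‖c‖ ≤ 2) ∧ ∀ c ∈ s, ∀ d ∈ s, c ≠ d → 1 ≤ ‖c - d‖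
  have hcard : ∀ s, good s → s.card ≤ 5 ^ Module.finrank ℝ E := fun s hs =>
    Besicovitch.card_le_of_separated s hs.1 hs.2
  let Q : ℕ → Prop := fun m => ∃ s, good s ∧ s.card = m
  obtain ⟨s, hs, hsm⟩ : Q (Nat.findGreatest Q (5 ^ Module.finrank ℝ E)) :=
    Nat.findGreatest_spec (P := Q) (Nat.zero_le _) ⟨∅, ⟨by simp, by simp⟩, rfl⟩
  have hmax : ∀ s', good s' → s'.card ≤ s.card := fun s' hs' => by
    rw [hsm]; exact Nat.le_findGreatest (hcard s' hs') ⟨s', hs', rfl⟩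
  refine ⟨s.image fun x => (1 / 2 : ℝ) • x, Finset.card_image_le.trans (hcard s hs), ?_, ?_⟩
  · intro x hx
    obtain ⟨y, hy, rfl⟩ := Finset.mem_image.mp hx
    have := hs.1 y hy
    rw [norm_smul]; norm_num; linarith
  · intro x hx
    have hx2 : ‖(2 : ℝ) • x‖ ≤ 2 := by rw [norm_smul]; norm_num; linarith
    have hclose : ∃ y ∈ s, ‖(2 : ℝ) • x - y‖ ≤ 1 := by
      by_contra! hc
      have hnot : (2 : ℝ) • x ∉ s := fun h => by
        have := hc _ h
        simp at this
        linarith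
      have hgood : good (insert ((2 : ℝ) • x) s) := by
        refine ⟨fun c hc' => ?_, fun c hc' d hd hcd => ?_⟩
        · rcases Finset.mem_insert.mp hc' with rfl | h
          exacts [hx2, hs.1 c h]
        · rcases Finset.mem_insert.mp hc' with rfl | h <;>
            rcases Finset.mem_insert.mp hd with rfl | h'
          · exact absurd rfl hcd
          · exact (hc d h').le
          · rw [norm_sub_rev]; exact (hc c h).le
          · exact hs.2 c h d h' hcd
      have := hmax _ hgood
      rw [Finset.card_insert_of_notMem hnot] at this
      omega
    obtain ⟨y, hy, hxy⟩ := hclose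
    refine ⟨(1 / 2 : ℝ) • y, Finset.mem_image_of_mem _ hy, ?_⟩
    have : x - (1 / 2 : ℝ) • y = (1 / 2 : ℝ) • ((2 : ℝ) • x - y) := by
      rw [smul_sub, smul_smul]; norm_num
    rw [this, norm_smul]; norm_num; linarith

/-- A bound for a linear functional on a `1/2`-net of the unit ball gives twice this bound on the
whole ball. -/
theorem le_two_mul_of_le_on_net {E : Type*} [NormedAddCommGroup E] [NormedSpace ℝ E]
    [FiniteDimensional ℝ E] {N : Finset E}
    (hN : ∀ x : E, ‖x‖ ≤ 1 → ∃ y ∈ N, ‖x - y‖ ≤ 1 / 2) (f : E →ₗ[ℝ] ℝ) {c : ℝ}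
    (hf : ∀ x ∈ N, f x ≤ c) {x : E} (hx : ‖x‖ ≤ 1) : f x ≤ 2 * c := by
  let g : E →L[ℝ] ℝ := LinearMap.toContinuousLinearMap f
  have hg : ∀ x, g x = f x := fun _ => rfl
  -- Self-improvement: the net error is at most $\|g\|/2$, and taking the supremum over $\pm x$
  -- gives $\|g\|\le 2c$.
  have hle : ∀ x : E, ‖x‖ ≤ 1 → g x ≤ c + ‖g‖ / 2 := by
    intro x hx
    obtain ⟨y, hy, hxy⟩ := hN x hx
    have h1 : g (x - y) ≤ ‖g‖ * ‖x - y‖ := (le_abs_self _).trans (g.le_opNorm _)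
    have h2 : ‖g‖ * ‖x - y‖ ≤ ‖g‖ * (1 / 2) := by gcongr
    have h3 := hf y hy
    rw [map_sub, hg y] at h1
    linarith
  have h0 : 0 ≤ c + ‖g‖ / 2 := by simpa using hle 0 (by simp)
  have hnorm : ‖g‖ ≤ c + ‖g‖ / 2 := by
    refine ContinuousLinearMap.opNorm_le_of_unit_norm h0 fun z hz => ?_
    rw [Real.norm_eq_abs, abs_le]
    have h1 := hle z hz.le
    have h2 := hle (-z) (by rw [norm_neg]; exact hz.le)
    rw [map_neg] at h2
    constructor <;> linarith
  have := hle x hx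
  rw [hg] at this
  linarith

/-- A family of vectors on `n × K` whose segments `j ↦ V (j, k)`, `Z j = l`, have Euclidean norm
at most one. -/
def SegmentBounded {n K : ℕ} (Z : Clustering n K) (V : Fin n × Fin K → ℝ) : Prop :=
  ∀ k l, ∑ j : Community Z l, V (j.1, k) ^ 2 ≤ 1

/-- A net for the Euclidean unit ball of the vectors supported on `J`. -/
theorem exists_net_euclidean {ι : Type*} [Fintype ι] [DecidableEq ι] (J : Finset ι) :
    ∃ N : Finset (ι → ℝ), N.card ≤ 5 ^ J.card ∧ (∀ U ∈ N, ∑ p, U p ^ 2 ≤ 1) ∧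
      ∀ (f : (ι → ℝ) →ₗ[ℝ] ℝ) (c : ℝ), (∀ U ∈ N, f U ≤ c) →
        ∀ U : ι → ℝ, (∀ p, p ∉ J → U p = 0) → ∑ p, U p ^ 2 ≤ 1 → f U ≤ 2 * c := by
  classical
  obtain ⟨N, hcard, hball, hnet⟩ := exists_half_net (EuclideanSpace ℝ J)
  let e : EuclideanSpace ℝ J →ₗ[ℝ] (ι → ℝ) :=
    { toFun := fun x p => if h : p ∈ J then x ⟨p, h⟩ else 0
      map_add' := fun x y => by ext p; by_cases h : p ∈ J <;> simp [h]
      map_smul' := fun a x => by ext p; by_cases h : p ∈ J <;> simp [h] }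
  have he : ∀ x p, e x p = if h : p ∈ J then x ⟨p, h⟩ else 0 := fun _ _ => rfl
  have hnorm : ∀ x, ∑ p, e x p ^ 2 = ‖x‖ ^ 2 := by
    intro x
    rw [EuclideanSpace.real_norm_sq_eq, ← Finset.sum_subset (Finset.subset_univ J)]
    · rw [← Finset.sum_coe_sort]
      exact Finset.sum_congr rfl fun p _ => by rw [he, dif_pos p.2]
    · intro p _ hp
      simp [he, hp]
  refine ⟨N.image e, Finset.card_image_le.trans (by simpa using hcard), ?_, ?_⟩
  · intro U hU
    obtain ⟨x, hx, rfl⟩ := Finset.mem_image.mp hU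
    rw [hnorm]
    exact pow_le_one₀ (norm_nonneg _) (hball x hx)
  · intro f c hf U hU hU1
    let x : EuclideanSpace ℝ J := WithLp.toLp 2 fun p => U p.1
    have hx : e x = U := by
      ext p
      by_cases h : p ∈ J
      · simp [he, h, x]
      · simp [he, h, hU p h]
    have hx1 : ‖x‖ ≤ 1 := by
      rw [← hx, hnorm] at hU1
      exact (sq_le_one_iff₀ (norm_nonneg _)).mp hU1
    have := le_two_mul_of_le_on_net hnet (f ∘ₗ e)
      (fun y hy => hf _ (Finset.mem_image_of_mem _ hy)) hx1
    rwa [LinearMap.comp_apply, hx] at this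

/-- A net for the segmentwise bounded vectors supported on `J`. -/
theorem exists_net_segmentBounded {n K : ℕ} (Z : Clustering n K) (J : Finset (Fin n × Fin K)) :
    ∃ N : Finset (Fin n × Fin K → ℝ), N.card ≤ 5 ^ J.card ∧ (∀ V ∈ N, SegmentBounded Z V) ∧
      ∀ (f : (Fin n × Fin K → ℝ) →ₗ[ℝ] ℝ) (c : ℝ), (∀ V ∈ N, f V ≤ c) →
        ∀ V : Fin n × Fin K → ℝ, (∀ p, p ∉ J → V p = 0) → SegmentBounded Z V →
          f V ≤ 2 * c := by
  classical
  -- In the product of the Euclidean spaces of the segments, the sup norm is at most one exactly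
  -- when every segment has norm at most one. The total dimension is still $|J|$, so the net does
  -- not grow with the number of segments.
  let I : Fin K × Fin K → Type := fun p => {j : Fin n // Z j = p.1 ∧ (j, p.2) ∈ J}
  let E : Type := (p : Fin K × Fin K) → EuclideanSpace ℝ (I p)
  obtain ⟨N, hcard, hball, hnet⟩ := exists_half_net E
  have hdim : Module.finrank ℝ E = J.card := by
    rw [Module.finrank_pi_fintype]
    simp only [finrank_euclideanSpace]
    rw [← Fintype.card_sigma, ← Fintype.card_coe]
    refine Fintype.card_congr
      ⟨fun q => ⟨(q.2.1, q.1.2), q.2.2.2⟩, fun q => ⟨(Z q.1.1, q.1.2), ⟨q.1.1, rfl, q.2⟩⟩,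
        ?_, ?_⟩
    · rintro ⟨⟨l, k⟩, ⟨j, hl, hj⟩⟩
      have hl' : Z j = l := hl
      subst hl'
      rfl
    · intro q; rfl
  let e : E →ₗ[ℝ] (Fin n × Fin K → ℝ) :=
    { toFun := fun x p => if h : p ∈ J then x (Z p.1, p.2) ⟨p.1, rfl, h⟩ else 0
      map_add' := fun x y => by ext p; by_cases h : p ∈ J <;> simp [h, E]
      map_smul' := fun a x => by ext p; by_cases h : p ∈ J <;> simp [h, E] }
  have he : ∀ x p, e x p = if h : p ∈ J then x (Z p.1, p.2) ⟨p.1, rfl, h⟩ else 0 :=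
    fun _ _ => rfl
  have hnorm : ∀ x k l, ∑ j : Community Z l, e x (j.1, k) ^ 2 = ‖x (l, k)‖ ^ 2 := by
    intro x k l
    rw [EuclideanSpace.real_norm_sq_eq]
    symm
    refine Finset.sum_of_injOn (fun j : I (l, k) => (⟨j.1, j.2.1⟩ : Community Z l)) ?_ ?_ ?_ ?_
    · intro a _ b _ h
      exact Subtype.ext (congrArg (fun j : Community Z l => j.1) h)
    · intro a _; simp
    · rintro ⟨j, rfl⟩ _ hj
      have : (j, k) ∉ J := fun h => hj ⟨⟨j, rfl, h⟩, by simp, rfl⟩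
      simp [he, this]
    · rintro ⟨j, hl, hj⟩ _
      have hl' : Z j = l := hl
      subst hl'
      have hj' : (j, k) ∈ J := hj
      simp [he, hj']
  refine ⟨N.image e, Finset.card_image_le.trans (hdim ▸ hcard), ?_, ?_⟩
  · intro V hV k l
    obtain ⟨x, hx, rfl⟩ := Finset.mem_image.mp hV
    rw [hnorm]
    exact pow_le_one₀ (norm_nonneg _) ((norm_le_pi_norm x _).trans (hball x hx))
  · intro f c hf V hV hV1
    let x : E := fun p => WithLp.toLp 2 fun j => V (j.1, p.2)
    have hx : e x = V := by
      ext p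
      by_cases h : p ∈ J
      · simp [he, h, x]
      · simp [he, h, hV p h]
    have hx1 : ‖x‖ ≤ 1 := by
      rw [pi_norm_le_iff_of_nonneg zero_le_one]
      rintro ⟨l, k⟩
      have := hV1 k l
      rw [← hx, hnorm] at this
      exact (sq_le_one_iff₀ (norm_nonneg _)).mp this
    have := le_two_mul_of_le_on_net hnet (f ∘ₗ e)
      (fun y hy => hf _ (Finset.mem_image_of_mem _ hy)) hx1
    rwa [LinearMap.comp_apply, hx] at this

/-! ### Frobenius and operator norms -/

section Norms

variable {m n : Type*} [Fintype m] [Fintype n]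

theorem frobSq_nonneg (X : Matrix m n ℝ) : 0 ≤ frobSq X :=
  Finset.sum_nonneg fun _ _ => Finset.sum_nonneg fun _ _ => sq_nonneg _

/-- The Frobenius inner product of two real matrices. -/
def frobInner (X Y : Matrix m n ℝ) : ℝ := ∑ i, ∑ j, X i j * Y i j

theorem frobSq_sub (X Y : Matrix m n ℝ) :
    frobSq (X - Y) = frobSq X - 2 * frobInner X Y + frobSq Y := by
  simp only [frobSq, frobInner, Finset.mul_sum, ← Finset.sum_sub_distrib,
    ← Finset.sum_add_distrib, Matrix.sub_apply]
  exact Finset.sum_congr rfl fun i _ => Finset.sum_congr rfl fun j _ => by ring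

theorem opNorm_nonneg [DecidableEq n] (X : Matrix m n ℝ) : 0 ≤ opNorm X := norm_nonneg _

theorem sum_mulVec_sq_le [DecidableEq n] (X : Matrix m n ℝ) (v : n → ℝ) :
    ∑ i, (X.mulVec v) i ^ 2 ≤ opNorm X ^ 2 * ∑ j, v j ^ 2 := by
  have h := (LinearMap.toContinuousLinearMap (Matrix.toEuclideanLin X)).le_opNorm
    (WithLp.toLp 2 v)
  have h2 := pow_le_pow_left₀ (norm_nonneg _) h 2
  rw [mul_pow, EuclideanSpace.real_norm_sq_eq, EuclideanSpace.real_norm_sq_eq] at h2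
  exact h2

/-- Compactness of the unit ball gives a maximizer, a top right singular vector. The constraint is
`≤ 1` rather than `= 1` so that an empty column set is allowed. -/
theorem exists_sum_mulVec_sq_eq [DecidableEq n] (X : Matrix m n ℝ) :
    ∃ v : n → ℝ, ∑ j, v j ^ 2 ≤ 1 ∧ ∑ i, (X.mulVec v) i ^ 2 = opNorm X ^ 2 := by
  let f := LinearMap.toContinuousLinearMap (Matrix.toEuclideanLin X)
  obtain ⟨x, hx, hmax⟩ := (isCompact_closedBall (0 : EuclideanSpace ℝ n) 1).exists_isMaxOn
    ⟨0, by simp⟩ (f := fun x => ‖f x‖) (by fun_prop)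
  have hx1 : ‖x‖ ≤ 1 := by simpa using hx
  have hle : ‖f‖ ≤ ‖f x‖ := ContinuousLinearMap.opNorm_le_of_unit_norm (norm_nonneg _)
    fun z hz => hmax (by simp [hz])
  have hx2 : ∑ j, x j ^ 2 ≤ 1 := by
    rw [← EuclideanSpace.real_norm_sq_eq]
    exact pow_le_one₀ (norm_nonneg _) hx1
  refine ⟨x, hx2, le_antisymm ?_ ?_⟩
  · exact (sum_mulVec_sq_le X x).trans (mul_le_of_le_one_right (sq_nonneg _) hx2)
  · have := pow_le_pow_left₀ (norm_nonneg _) hle 2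
    rw [EuclideanSpace.real_norm_sq_eq] at this
    exact this

theorem opNorm_add_le [DecidableEq n] (X Y : Matrix m n ℝ) :
    opNorm (X + Y) ≤ opNorm X + opNorm Y := by
  unfold opNorm
  rw [map_add, map_add]
  exact norm_add_le _ _

theorem opNorm_sq_le_frobSq [DecidableEq n] (X : Matrix m n ℝ) : opNorm X ^ 2 ≤ frobSq X := by
  obtain ⟨v, hv, h⟩ := exists_sum_mulVec_sq_eq X
  rw [← h]
  refine Finset.sum_le_sum fun i _ => ?_
  calc (X.mulVec v) i ^ 2 = (∑ j, X i j * v j) ^ 2 := rfl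
    _ ≤ (∑ j, X i j ^ 2) * ∑ j, v j ^ 2 := Finset.sum_mul_sq_le_sq_mul_sq _ _ _
    _ ≤ ∑ j, X i j ^ 2 :=
      mul_le_of_le_one_right (Finset.sum_nonneg fun _ _ => sq_nonneg _) hv

theorem opNorm_add_sq_le [DecidableEq n] (X Y : Matrix m n ℝ) {ε : ℝ} (hε : 0 < ε) :
    opNorm (X + Y) ^ 2 ≤ (1 + ε) * opNorm X ^ 2 + (1 + 1 / ε) * opNorm Y ^ 2 := by
  have h := pow_le_pow_left₀ (opNorm_nonneg _) (opNorm_add_le X Y) 2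
  have h2 : 0 ≤ (ε * opNorm X - opNorm Y) ^ 2 / ε := by positivity
  have h3 : (ε * opNorm X - opNorm Y) ^ 2 / ε =
      ε * opNorm X ^ 2 - 2 * opNorm X * opNorm Y + 1 / ε * opNorm Y ^ 2 := by
    field_simp; ring
  nlinarith

theorem exists_eq_vecMulVec_of_rank_le_one {M : Matrix m n ℝ} (hM : M.rank ≤ 1) :
    ∃ u v, M = Matrix.vecMulVec u v := by
  by_cases h0 : M = 0
  · exact ⟨0, 0, by simp [h0]⟩
  · obtain ⟨i, j, hij⟩ : ∃ i j, M i j ≠ 0 := by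
      by_contra! hc
      exact h0 (Matrix.ext hc)
    refine ⟨fun i' => M i' j / M i j, M i, ?_⟩
    ext i' j'
    rw [Matrix.vecMulVec_apply]
    field_simp
    rw [(rank_le_one_iff_minors M).mp hM i' i j' j]

/-- The distance of a matrix to the matrices of rank at most one. -/
theorem frobSq_sub_opNorm_sq_le [DecidableEq n] (X : Matrix m n ℝ) {Y : Matrix m n ℝ}
    (hY : Y.rank ≤ 1) : frobSq X - opNorm X ^ 2 ≤ frobSq (X - Y) := by
  obtain ⟨u, v, rfl⟩ := exists_eq_vecMulVec_of_rank_le_one hY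
  have hsq : frobSq (Matrix.vecMulVec u v) = (∑ i, u i ^ 2) * ∑ j, v j ^ 2 := by
    simp only [frobSq, Matrix.vecMulVec_apply, mul_pow, Finset.sum_mul_sum]
  have hin : frobInner X (Matrix.vecMulVec u v) = ∑ i, u i * (X.mulVec v) i := by
    simp only [frobInner, Matrix.vecMulVec_apply, Matrix.mulVec, dotProduct, Finset.mul_sum]
    exact Finset.sum_congr rfl fun i _ => Finset.sum_congr rfl fun j _ => by ring
  -- Cauchy–Schwarz gives $\langle X,Y\rangle\le\|X\|_{op}\|Y\|_F$ for rank one $Y$; then $2ab\le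
  -- a^2+b^2$ absorbs the cross term in $\|X-Y\|_F^2$.
  have hcs : frobInner X (Matrix.vecMulVec u v) ^ 2 ≤
      opNorm X ^ 2 * frobSq (Matrix.vecMulVec u v) := by
    rw [hin, hsq]
    calc _ ≤ (∑ i, u i ^ 2) * ∑ i, (X.mulVec v) i ^ 2 := Finset.sum_mul_sq_le_sq_mul_sq _ _ _
      _ ≤ (∑ i, u i ^ 2) * (opNorm X ^ 2 * ∑ j, v j ^ 2) :=
        mul_le_mul_of_nonneg_left (sum_mulVec_sq_le X v)
          (Finset.sum_nonneg fun _ _ => sq_nonneg _)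
      _ = _ := by ring
  rw [frobSq_sub]
  have hle : 2 * frobInner X (Matrix.vecMulVec u v) ≤
      opNorm X ^ 2 + frobSq (Matrix.vecMulVec u v) := by
    have h0 := frobSq_nonneg (Matrix.vecMulVec u v)
    refine le_of_sq_le_sq ?_ (by positivity)
    nlinarith [sq_nonneg (opNorm X ^ 2 - frobSq (Matrix.vecMulVec u v))]
  linarith

end Norms

/-! ### Blocks -/

section Blocks

variable {n K : ℕ} (Z : Clustering n K)

theorem sum_sum_community (f : Fin n → ℝ) : ∑ k, ∑ i : Community Z k, f i.1 = ∑ i, f i :=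
  Fintype.sum_fiberwise (g := Z) (f := f)

theorem sum_frobSq_block (B : Matrix (Fin n) (Fin n) ℝ) :
    ∑ k, ∑ l, frobSq (block Z B k l) = frobSq B := by
  have h : ∀ k, ∑ l, frobSq (block Z B k l) = ∑ i : Community Z k, ∑ j, B i.1 j ^ 2 := by
    intro k
    simp only [frobSq, block, Matrix.submatrix_apply]
    rw [Finset.sum_comm]
    exact Finset.sum_congr rfl fun i _ => sum_sum_community Z fun j => B i.1 j ^ 2
  simp only [h]
  exact sum_sum_community Z fun i => ∑ j, B i j ^ 2

theorem block_add (B C : Matrix (Fin n) (Fin n) ℝ) (k l : Fin K) :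
    block Z (B + C) k l = block Z B k l + block Z C k l := rfl

/-- The sum over the blocks of the squared operator norms. -/
def opSq (B : Matrix (Fin n) (Fin n) ℝ) : ℝ := ∑ k, ∑ l, opNorm (block Z B k l) ^ 2

theorem opSq_nonneg (B : Matrix (Fin n) (Fin n) ℝ) : 0 ≤ opSq Z B :=
  Finset.sum_nonneg fun _ _ => Finset.sum_nonneg fun _ _ => sq_nonneg _

theorem opSq_le_frobSq (B : Matrix (Fin n) (Fin n) ℝ) : opSq Z B ≤ frobSq B := by
  rw [← sum_frobSq_block Z B]
  exact Finset.sum_le_sum fun _ _ => Finset.sum_le_sum fun _ _ => opNorm_sq_le_frobSq _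

theorem opSq_add_le (B C : Matrix (Fin n) (Fin n) ℝ) {ε : ℝ} (hε : 0 < ε) :
    opSq Z (B + C) ≤ (1 + ε) * opSq Z B + (1 + 1 / ε) * opSq Z C := by
  simp only [opSq, Finset.mul_sum, ← Finset.sum_add_distrib]
  exact Finset.sum_le_sum fun k _ => Finset.sum_le_sum fun l _ => by
    rw [block_add]; exact opNorm_add_sq_le _ _ hε

/-- The matrix with blocks of rank one built from two popularity vectors. -/
def pairMatrix (U V : Fin n × Fin K → ℝ) : Matrix (Fin n) (Fin n) ℝ :=
  Matrix.of fun i j => U (i, Z j) * V (j, Z i)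

theorem sum_sum_pair (U : Fin n × Fin K → ℝ) (W : Fin n → Fin n → ℝ) :
    ∑ i, ∑ j, U (i, Z j) * W i j = ∑ p : Fin n × Fin K, U p * ∑ j : Community Z p.2, W p.1 j.1 := by
  rw [Fintype.sum_prod_type]
  refine Finset.sum_congr rfl fun i _ => ?_
  rw [← sum_sum_community Z]
  refine Finset.sum_congr rfl fun l _ => ?_
  rw [Finset.mul_sum]
  exact Finset.sum_congr rfl fun j _ => by rw [j.2]

/-- Each $U_{(i,l)}^2$ is multiplied by the squared norm of a single segment of $V$. Hence $V$ needs
only segmentwise bounds, while $U$ is bounded globally. -/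
theorem frobSq_pairMatrix_le_one {U V : Fin n × Fin K → ℝ} (hU : ∑ p, U p ^ 2 ≤ 1)
    (hV : SegmentBounded Z V) : frobSq (pairMatrix Z U V) ≤ 1 := by
  simp only [frobSq, pairMatrix, Matrix.of_apply, mul_pow]
  rw [sum_sum_pair Z (fun p => U p ^ 2) (fun i j => V (j, Z i) ^ 2)]
  refine le_trans (Finset.sum_le_sum fun p _ => ?_) hU
  exact mul_le_of_le_one_right (sq_nonneg _) (hV _ _)

/-- Finitely many test matrices of Frobenius norm at most one control the operator norms of the
blocks of all matrices whose blocks are supported by `J`. -/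
theorem exists_test_matrices (J : Finset (Fin n × Fin K)) :
    ∃ T : Finset (Matrix (Fin n) (Fin n) ℝ), T.card ≤ 25 ^ J.card ∧ (∀ M ∈ T, frobSq M ≤ 1) ∧
      ∀ (X : Matrix (Fin n) (Fin n) ℝ) (s : ℝ),
        (∀ i j, X i j ≠ 0 → (i, Z j) ∈ J ∧ (j, Z i) ∈ J) →
        (∀ M ∈ T, frobInner X M ≤ s) → opSq Z X ≤ 16 * s ^ 2 := by
  classical
  obtain ⟨N, hNcard, hN1, hN⟩ := exists_net_euclidean J
  obtain ⟨N', hN'card, hN'1, hN'⟩ := exists_net_segmentBounded Z J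
  refine ⟨(N ×ˢ N').image fun q => pairMatrix Z q.1 q.2, ?_, ?_, ?_⟩
  · refine Finset.card_image_le.trans ?_
    rw [Finset.card_product]
    calc _ ≤ 5 ^ J.card * 5 ^ J.card := Nat.mul_le_mul hNcard hN'card
      _ = 25 ^ J.card := by rw [← mul_pow]; norm_num
  · intro M hM
    obtain ⟨q, hq, rfl⟩ := Finset.mem_image.mp hM
    rw [Finset.mem_product] at hq
    exact frobSq_pairMatrix_le_one Z (hN1 _ hq.1) (hN'1 _ hq.2)
  · intro X s hX hs
    let left : (Fin n × Fin K → ℝ) → (Fin n × Fin K → ℝ) →ₗ[ℝ] ℝ := fun V =>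
      { toFun := fun U => frobInner X (pairMatrix Z U V)
        map_add' := fun U U' => by
          simp only [frobInner, pairMatrix, Matrix.of_apply, Pi.add_apply,
            ← Finset.sum_add_distrib, add_mul, mul_add]
        map_smul' := fun a U => by
          simp only [frobInner, pairMatrix, Matrix.of_apply, Pi.smul_apply, smul_eq_mul,
            Finset.mul_sum, RingHom.id_apply]
          exact Finset.sum_congr rfl fun i _ => Finset.sum_congr rfl fun j _ => by ring }
    let right : (Fin n × Fin K → ℝ) → (Fin n × Fin K → ℝ) →ₗ[ℝ] ℝ := fun U =>
      { toFun := fun V => frobInner X (pairMatrix Z U V)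
        map_add' := fun V V' => by
          simp only [frobInner, pairMatrix, Matrix.of_apply, Pi.add_apply,
            ← Finset.sum_add_distrib, mul_add]
        map_smul' := fun a V => by
          simp only [frobInner, pairMatrix, Matrix.of_apply, Pi.smul_apply, smul_eq_mul,
            Finset.mul_sum, RingHom.id_apply]
          exact Finset.sum_congr rfl fun i _ => Finset.sum_congr rfl fun j _ => by ring }
    have hball : ∀ U V : Fin n × Fin K → ℝ, (∀ p, p ∉ J → U p = 0) → (∀ p, p ∉ J → V p = 0) →
        ∑ p, U p ^ 2 ≤ 1 → SegmentBounded Z V → frobInner X (pairMatrix Z U V) ≤ 4 * s := by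
      -- The form is linear in each argument, so each of the two nets costs a factor 2; squaring the
      -- total factor 4 gives the constant 16.
      intro U V hUJ hVJ hU1 hV1
      have h := hN' (right U) (2 * s) (fun V' hV' => hN (left V') s (fun U' hU' =>
        hs _ (Finset.mem_image.mpr ⟨(U', V'), Finset.mem_product.mpr ⟨hU', hV'⟩, rfl⟩))
        U hUJ hU1) V hVJ hV1
      have h' : frobInner X (pairMatrix Z U V) ≤ 2 * (2 * s) := h
      linarith
    -- The top right singular vectors of all blocks fit into one $V$, because block $(k,l)$ alone
    -- uses the entries $V_{(j,k)}$ with $Z_j=l$. Truncation to $J$ loses nothing, since the removed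
    -- entries meet zero columns of the block.
    choose v hv1 hv2 using fun k l => exists_sum_mulVec_sq_eq (block Z X k l)
    let V : Fin n × Fin K → ℝ := fun p => if p ∈ J then v p.2 (Z p.1) ⟨p.1, rfl⟩ else 0
    have hVseg : SegmentBounded Z V := by
      intro k l
      refine le_trans (Finset.sum_le_sum ?_) (hv1 k l)
      rintro ⟨j, rfl⟩ _
      by_cases h : (j, k) ∈ J
      · simp [V, h]
      · simp [V, h, sq_nonneg]
    let g : Fin n × Fin K → ℝ := fun p => ∑ j : Community Z p.2, X p.1 j.1 * V (j.1, Z p.1)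
    have hg : ∀ k l (i : Community Z k), g (i.1, l) = (block Z X k l).mulVec (v k l) i := by
      rintro k l ⟨i, rfl⟩
      refine Finset.sum_congr rfl ?_
      rintro ⟨j, hj⟩ _
      have hj' : Z j = l := hj
      subst hj'
      change X i j * V (j, Z i) = X i j * v (Z i) (Z j) ⟨j, rfl⟩
      by_cases h : X i j = 0
      · simp [h]
      · simp [V, (hX i j h).2]
    have hgJ : ∀ p, p ∉ J → g p = 0 := by
      rintro ⟨i, l⟩ hp
      refine Finset.sum_eq_zero ?_
      rintro ⟨j, hj⟩ _
      have hj' : Z j = l := hj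
      subst hj'
      by_cases h : X i j = 0
      · simp [h]
      · exact absurd (hX i j h).1 hp
    have hsum : ∑ p, g p ^ 2 = opSq Z X := by
      rw [Fintype.sum_prod_type, ← sum_sum_community Z]
      refine Finset.sum_congr rfl fun k _ => ?_
      rw [Finset.sum_comm]
      refine Finset.sum_congr rfl fun l _ => ?_
      rw [← hv2]
      exact Finset.sum_congr rfl fun i _ => by rw [hg]
    have hinner : ∀ U, frobInner X (pairMatrix Z U V) = ∑ p, U p * g p := by
      intro U
      rw [← sum_sum_pair Z U fun i j => X i j * V (j, Z i)]
      simp only [frobInner, pairMatrix, Matrix.of_apply]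
      exact Finset.sum_congr rfl fun i _ => Finset.sum_congr rfl fun j _ => by ring
    rcases (opSq_nonneg Z X).eq_or_lt with h0 | hpos
    · rw [← h0]; positivity
    · have hr : 0 < √(opSq Z X) := Real.sqrt_pos.mpr hpos
      have hrr : √(opSq Z X) ^ 2 = opSq Z X := Real.sq_sqrt hpos.le
      -- For this $V$ the optimal $U$ is $g/\|g\|$, with $\|g\|^2$ equal to `opSq Z X`, and the form
      -- takes the value $\|g\|$.
      have key := hball (fun p => (√(opSq Z X))⁻¹ * g p) V (fun p hp => by simp [hgJ p hp])
        (fun p hp => by simp [V, hp])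
        (by simp only [mul_pow, ← Finset.mul_sum, hsum, inv_pow, hrr]
            rw [inv_mul_cancel₀ hpos.ne']) hVseg
      rw [hinner] at key
      simp only [mul_assoc, ← Finset.mul_sum, ← sq, hsum] at key
      rw [inv_mul_le_iff₀ hr] at key
      have h4 : √(opSq Z X) ≤ 4 * s :=
        le_of_mul_le_mul_left (by rw [← sq, hrr]; exact key) hr
      calc opSq Z X = √(opSq Z X) ^ 2 := hrr.symm
        _ ≤ (4 * s) ^ 2 := pow_le_pow_left₀ hr.le h4 2
        _ = 16 * s ^ 2 := by ring

end Blocks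

/-! ### Concentration -/

section Tail

variable {n : ℕ} {Ω : Type*} [MeasurableSpace Ω] {μ : Measure Ω}
  {A : Ω → Matrix (Fin n) (Fin n) ℝ} {P : Matrix (Fin n) (Fin n) ℝ}

/-- The entrywise expectation of a random matrix. -/
def meanMatrix (μ : Measure Ω) (A : Ω → Matrix (Fin n) (Fin n) ℝ) : Matrix (Fin n) (Fin n) ℝ :=
  Matrix.of fun i j => ∫ ω, A ω i j ∂μ

theorem IsRandomAdjacency.integral_eq (hA : IsRandomAdjacency μ A P) (i j : Fin n) :
    ∫ ω, A ω i j ∂μ = μ.real {ω | A ω i j = 1} := by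
  have hmeas : MeasurableSet {ω | A ω i j = 1} :=
    hA.measurable i j (measurableSet_singleton 1)
  rw [← integral_indicator_one hmeas]
  refine integral_congr_ae (Filter.Eventually.of_forall fun ω => ?_)
  rcases hA.zero_or_one ω i j with h | h <;> simp [Set.indicator, h]

theorem IsRandomAdjacency.mean_offDiag (hA : IsRandomAdjacency μ A P)
    (hP : ∀ i j, P i j = P j i) {i j : Fin n} (hij : i ≠ j) : meanMatrix μ A i j = P i j := by
  change ∫ ω, A ω i j ∂μ = P i j
  rcases lt_or_gt_of_ne hij with h | h
  · rw [hA.integral_eq, hA.prob i j h]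
  · simp only [hA.symm _ i j]
    rw [hA.integral_eq, hA.prob j i h, hP]

theorem IsRandomAdjacency.mean_diag (hA : IsRandomAdjacency μ A P) (i : Fin n) :
    meanMatrix μ A i i = P i i ∨ meanMatrix μ A i i = 0 := by
  rcases hA.diag with h | h
  · left
    change ∫ ω, A ω i i ∂μ = P i i
    rw [hA.integral_eq, h]
  · right
    change ∫ ω, A ω i i ∂μ = 0
    simp [h]

/-- Almost surely, there are no edges where the connection probability vanishes. -/
theorem IsRandomAdjacency.ae_eq_zero [IsProbabilityMeasure μ] (hA : IsRandomAdjacency μ A P)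
    (hP : ∀ i j, P i j = P j i) : ∀ᵐ ω ∂μ, ∀ i j, P i j = 0 → A ω i j = 0 := by
  rw [ae_all_iff]; intro i
  rw [ae_all_iff]; intro j
  by_cases hp : P i j = 0
  · have hm : meanMatrix μ A i j = 0 := by
      by_cases hij : i = j
      · subst hij
        rcases hA.mean_diag i with h | h
        exacts [h.trans hp, h]
      · rw [hA.mean_offDiag hP hij, hp]
    have h1 : μ.real {ω | A ω i j = 1} = 0 := by rw [← hA.integral_eq]; exact hm
    rw [measureReal_eq_zero_iff] at h1
    have h2 : ∀ᵐ ω ∂μ, A ω i j ≠ 1 := by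
      rw [ae_iff]; simpa using h1
    filter_upwards [h2] with ω hω _
    exact (hA.zero_or_one ω i j).resolve_right hω
  · exact Filter.Eventually.of_forall fun ω h => absurd h hp

/-- The sum of all entries of a matrix, arranged over the positions on and above the diagonal. -/
theorem sum_sum_eq_sum_upper (f : Fin n → Fin n → ℝ) :
    ∑ i, ∑ j, f i j = ∑ p : {p : Fin n × Fin n // p.1 ≤ p.2},
      if p.1.1 = p.1.2 then f p.1.1 p.1.2 else f p.1.1 p.1.2 + f p.1.2 p.1.1 := by
  rw [← Finset.sum_subtype (Finset.univ.filter fun p : Fin n × Fin n => p.1 ≤ p.2)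
    (p := fun p : Fin n × Fin n => p.1 ≤ p.2) (by simp)
    (fun p => if p.1 = p.2 then f p.1 p.2 else f p.1 p.2 + f p.2 p.1), Finset.sum_filter,
    Fintype.sum_prod_type]
  have h : ∀ i j, (if i ≤ j then (if i = j then f i j else f i j + f j i) else 0) =
      (if i ≤ j then f i j else 0) + (if i < j then f j i else 0) := by
    intro i j
    rcases lt_trichotomy i j with h | h | h
    · simp [h.le, h.ne, h]
    · simp [h]
    · simp [h.not_ge, h.not_gt]
  simp only [h, Finset.sum_add_distrib]
  rw [Finset.sum_comm (f := fun i j => if i < j then f j i else 0), ← Finset.sum_add_distrib]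
  refine Finset.sum_congr rfl fun i _ => ?_
  rw [← Finset.sum_add_distrib]
  refine Finset.sum_congr rfl fun j _ => ?_
  rcases le_or_gt i j with h | h
  · simp [h, h.not_gt]
  · simp [h, h.not_ge]

/-- Grouping symmetric positions writes the inner product as a sum of independent centered terms. By
Hoeffding's lemma their variance proxies are $w_p^2/4$. Merging $(i,j)$ with $(j,i)$ at most doubles
the squared weights, so the total proxy is at most $1/2$. -/
theorem IsRandomAdjacency.tail [IsProbabilityMeasure μ] (hA : IsRandomAdjacency μ A P)
    {M : Matrix (Fin n) (Fin n) ℝ} (hM : frobSq M ≤ 1) {s : ℝ} (hs : 0 ≤ s) :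
    μ.real {ω | s ≤ frobInner (A ω - meanMatrix μ A) M} ≤ Real.exp (-s ^ 2) := by
  let U := {p : Fin n × Fin n // p.1 ≤ p.2}
  let w : U → ℝ := fun p => if p.1.1 = p.1.2 then M p.1.1 p.1.2 else M p.1.1 p.1.2 + M p.1.2 p.1.1
  let X : U → Ω → ℝ := fun p ω => w p * (A ω p.1.1 p.1.2 - ∫ ω, A ω p.1.1 p.1.2 ∂μ)
  have hXsum : ∀ ω, frobInner (A ω - meanMatrix μ A) M = ∑ p, X p ω := by
    intro ω
    rw [frobInner, sum_sum_eq_sum_upper]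
    refine Finset.sum_congr rfl fun p _ => ?_
    have hs : ∀ ω, A ω p.1.2 p.1.1 = A ω p.1.1 p.1.2 := fun ω => hA.symm ω _ _
    simp only [X, w, Matrix.sub_apply, meanMatrix, Matrix.of_apply, hs]
    split_ifs <;> ring
  have hind : iIndepFun X μ :=
    hA.indep.comp (fun p x => w p * (x - ∫ ω, A ω p.1.1 p.1.2 ∂μ)) fun p => by fun_prop
  let c : U → NNReal := fun p => NNReal.mk (w p ^ 2) (sq_nonneg _) * (‖(1 : ℝ) - 0‖₊ / 2) ^ 2
  have hcw : ∀ p, (c p : ℝ) = w p ^ 2 * (1 / 4) := by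
    intro p
    rw [NNReal.coe_mul, NNReal.coe_mk]
    norm_num
  have hsub : ∀ p, HasSubgaussianMGF (X p) (c p) μ := by
    intro p
    refine (hasSubgaussianMGF_of_mem_Icc (hA.measurable _ _).aemeasurable
      (Filter.Eventually.of_forall fun ω => ?_)).const_mul (w p)
    rcases hA.zero_or_one ω p.1.1 p.1.2 with h | h <;> simp [h]
  have hS := HasSubgaussianMGF.sum_of_iIndepFun hind (s := Finset.univ) fun p _ => hsub p
  have hw : ∑ p, w p ^ 2 ≤ 2 := by
    have h1 : ∑ p, w p ^ 2 ≤ 2 * frobSq M := by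
      rw [frobSq, sum_sum_eq_sum_upper, Finset.mul_sum]
      refine Finset.sum_le_sum fun p _ => ?_
      simp only [w]
      split_ifs
      · nlinarith [sq_nonneg (M p.1.1 p.1.2)]
      · nlinarith [sq_nonneg (M p.1.1 p.1.2 - M p.1.2 p.1.1)]
    linarith
  have hc : ((∑ p, c p : NNReal) : ℝ) ≤ 1 / 2 := by
    rw [NNReal.coe_sum]
    simp only [hcw]
    rw [← Finset.sum_mul]
    linarith
  simp only [hXsum]
  -- Chernoff at parameter $2s$, optimal for proxy $1/2$: the exponent is $-2s^2+s^2$.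
  have h2s : 0 ≤ 2 * s := by linarith
  refine (measure_ge_le_exp_mul_mgf s h2s (hS.integrable_exp_mul _)).trans ?_
  refine (mul_le_mul_of_nonneg_left (hS.mgf_le _) (Real.exp_pos _).le).trans ?_
  rw [← Real.exp_add, Real.exp_le_exp]
  nlinarith [sq_nonneg s]

end Tail

/-! ### Entropy terms and penalties -/

theorem entropyTerm_eq {N x : ℕ} (hN : 0 < N) (hx : 0 < x) :
    entropyTerm N x = x * (1 + Real.log N - Real.log x) := by
  have h1 : (N : ℝ) ≠ 0 := by positivity
  have h2 : (x : ℝ) ≠ 0 := by positivity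
  rw [entropyTerm, Real.log_div (mul_ne_zero h1 (Real.exp_pos _).ne') h2,
    Real.log_mul h1 (Real.exp_pos _).ne', Real.log_exp]
  ring

theorem le_entropyTerm {N x : ℕ} (h : x ≤ N) : (x : ℝ) ≤ entropyTerm N x := by
  rcases x.eq_zero_or_pos with rfl | hx
  · simp [entropyTerm]
  · rw [entropyTerm_eq (hx.trans_le h) hx]
    have hl : Real.log x ≤ Real.log N := Real.log_le_log (by positivity) (by exact_mod_cast h)
    have hx' : (0 : ℝ) < x := by positivity
    nlinarith

theorem entropyTerm_nonneg {N x : ℕ} (h : x ≤ N) : 0 ≤ entropyTerm N x :=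
  (Nat.cast_nonneg x).trans (le_entropyTerm h)

theorem log_le_entropyTerm {N x : ℕ} (hx : 0 < x) (h : x ≤ N) :
    Real.log N ≤ entropyTerm N x := by
  rw [entropyTerm_eq (hx.trans_le h) hx]
  have hx1 : (1 : ℝ) ≤ x := by exact_mod_cast hx
  have hl : Real.log x ≤ Real.log N := Real.log_le_log (by positivity) (by exact_mod_cast h)
  have hlx : Real.log x ≤ x - 1 := Real.log_le_sub_one_of_pos (by linarith)
  nlinarith

/-- The log sum inequality for entropy terms. -/
theorem sum_entropyTerm_le {ι : Type*} (s : Finset ι) (N x : ι → ℕ) (h : ∀ i ∈ s, x i ≤ N i) :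
    ∑ i ∈ s, entropyTerm (N i) (x i) ≤ entropyTerm (∑ i ∈ s, N i) (∑ i ∈ s, x i) := by
  rcases (∑ i ∈ s, x i).eq_zero_or_pos with h0 | hpos
  · rw [h0]
    have : ∀ i ∈ s, x i = 0 := by simpa using h0
    rw [Finset.sum_eq_zero fun i hi => by simp [this i hi, entropyTerm]]
    simp [entropyTerm]
  · have hNpos : 0 < ∑ i ∈ s, N i := hpos.trans_le (Finset.sum_le_sum h)
    rw [entropyTerm_eq hNpos hpos]
    set a : ℝ := ((∑ i ∈ s, x i : ℕ) : ℝ) with ha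
    set b : ℝ := ((∑ i ∈ s, N i : ℕ) : ℝ) with hb
    have ha0 : 0 < a := by rw [ha]; exact_mod_cast hpos
    have hb0 : 0 < b := by rw [hb]; exact_mod_cast hNpos
    -- Tangent bound $\ln y\le y-1$ at $y=aN_i/(bx_i)$; the linear corrections sum to zero.
    have hi : ∀ i ∈ s, entropyTerm (N i) (x i) ≤
        x i * (1 + Real.log b - Real.log a) + (a / b * N i - x i) := by
      intro i his
      rcases (x i).eq_zero_or_pos with hx | hx
      · rw [hx]
        simp only [entropyTerm, Nat.cast_zero, zero_mul, sub_zero, zero_add]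
        positivity
      · have hN := hx.trans_le (h i his)
        rw [entropyTerm_eq hN hx]
        have hx' : (0 : ℝ) < x i := by positivity
        have hN' : (0 : ℝ) < N i := by positivity
        have hlog := Real.log_le_sub_one_of_pos (show 0 < a / b * N i / x i by positivity)
        rw [Real.log_div (by positivity) hx'.ne', Real.log_mul (by positivity) hN'.ne',
          Real.log_div ha0.ne' hb0.ne'] at hlog
        have := mul_le_mul_of_nonneg_left hlog hx'.le
        rw [mul_sub _ (a / b * N i / x i), mul_div_cancel₀ _ hx'.ne'] at this
        linarith
    refine (Finset.sum_le_sum hi).trans ?_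
    rw [Finset.sum_add_distrib, ← Finset.sum_mul, Finset.sum_sub_distrib, ← Finset.mul_sum,
      ← Nat.cast_sum, ← Nat.cast_sum, ← ha, ← hb, div_mul_cancel₀ _ hb0.ne', sub_self, add_zero]

section Penalty

variable {n K : ℕ} (Z : Clustering n K) (J : Finset (Fin n × Fin K))

theorem card_part_le (k l : Fin K) : (part Z J k l).card ≤ commSize Z k :=
  Finset.card_le_univ _

theorem card_le_mul : J.card ≤ n * K := by
  simpa using Finset.card_le_univ J

theorem sum_commSize : ∑ k, commSize Z k = n := by
  unfold commSize
  rw [← Fintype.card_sigma]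
  simpa using Fintype.card_congr (Equiv.sigmaFiberEquiv Z)

theorem sum_card_part : ∑ k, ∑ l, (part Z J k l).card = J.card := by
  have h : ∀ k l, (part Z J k l).card = ∑ i : Community Z k, if (i.1, l) ∈ J then 1 else 0 := by
    intro k l
    rw [part, Finset.card_filter]
  simp only [h]
  rw [Finset.sum_congr rfl fun k _ => Finset.sum_comm]
  rw [Fintype.sum_fiberwise (g := Z) (f := fun i => ∑ l, if (i, l) ∈ J then 1 else 0),
    ← Fintype.sum_prod_type' (fun i l => if (i, l) ∈ J then 1 else 0)]
  simp

theorem sum_entropyTerm_part_le :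
    ∑ k, ∑ l, entropyTerm (commSize Z k) (part Z J k l).card ≤ entropyTerm (n * K) J.card := by
  have h := sum_entropyTerm_le (Finset.univ : Finset (Fin K × Fin K))
    (fun p => commSize Z p.1) (fun p => (part Z J p.1 p.2).card) fun p _ => card_part_le Z J _ _
  rw [Fintype.sum_prod_type, Fintype.sum_prod_type, Fintype.sum_prod_type, sum_card_part] at h
  simpa [← Finset.mul_sum, sum_commSize, mul_comm] using h

theorem penBase_le_of_penalty {β₁ β₂ : ℝ} (hβ₁ : 0 < β₁) (hβ₂ : 0 < β₂)
    {pen : Clustering n K → Finset (Fin n × Fin K) → ℝ}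
    (hpen : pen = sepPenalty β₁ β₂ ∨ pen = nonsepPenalty β₁ β₂) : penBase β₂ n K ≤ pen Z J := by
  rcases hpen with rfl | rfl
  · have h1 : 0 ≤ ∑ k, ∑ l, entropyTerm (commSize Z k) (part Z J k l).card :=
      Finset.sum_nonneg fun k _ => Finset.sum_nonneg fun l _ =>
        entropyTerm_nonneg (card_part_le Z J k l)
    have h2 : 0 ≤ ∑ k, Real.log (commSize Z k) :=
      Finset.sum_nonneg fun k _ => Real.log_natCast_nonneg _
    unfold sepPenalty
    have : 0 ≤ β₂ * K * ∑ k, Real.log (commSize Z k) := by positivity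
    have : 0 ≤ β₁ * ∑ k, ∑ l, entropyTerm (commSize Z k) (part Z J k l).card := by positivity
    linarith
  · have h1 := mul_nonneg hβ₁.le (entropyTerm_nonneg (card_le_mul J))
    have h2 := mul_nonneg (mul_nonneg zero_le_two hβ₂.le) (Real.log_natCast_nonneg n)
    unfold nonsepPenalty
    linarith

/-- Since every part is nonempty, each of the $K^2$ entropy terms dominates its $\ln n_k$, so the
logarithmic part of the penalty is absorbed into the entropy. The non-separable penalty accounts for
the factor $2\beta_2$. -/
theorem penalty_le {β₁ β₂ : ℝ} (hβ₁ : 0 < β₁) (hβ₂ : 0 < β₂) (hK : 0 < K)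
    (hJ : ∀ k l, (part Z J k l).Nonempty)
    {pen : Clustering n K → Finset (Fin n × Fin K) → ℝ}
    (hpen : pen = sepPenalty β₁ β₂ ∨ pen = nonsepPenalty β₁ β₂) :
    pen Z J ≤ penBase β₂ n K + (β₁ + 2 * β₂) * entropyTerm (n * K) J.card := by
  have hle := sum_entropyTerm_part_le Z J
  have hH := entropyTerm_nonneg (card_le_mul J)
  rcases hpen with rfl | rfl
  · have h2 : K * ∑ k, Real.log (commSize Z k) ≤
        ∑ k, ∑ l, entropyTerm (commSize Z k) (part Z J k l).card := by
      rw [Finset.mul_sum]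
      refine Finset.sum_le_sum fun k _ => ?_
      have : ∑ _l : Fin K, Real.log (commSize Z k) = K * Real.log (commSize Z k) := by simp
      rw [← this]
      exact Finset.sum_le_sum fun l _ =>
        log_le_entropyTerm (Finset.card_pos.mpr (hJ k l)) (card_part_le Z J k l)
    unfold sepPenalty
    have h3 := mul_le_mul_of_nonneg_left hle hβ₁.le
    have h4 := mul_le_mul_of_nonneg_left (h2.trans hle) hβ₂.le
    have h5 := mul_nonneg hβ₂.le hH
    rw [mul_assoc β₂]
    linarith
  · obtain ⟨i, hi⟩ := hJ ⟨0, hK⟩ ⟨0, hK⟩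
    have hpos : 0 < J.card := Finset.card_pos.mpr ⟨_, (Finset.mem_filter.mp hi).2⟩
    have hn : 0 < n := i.1.pos
    have h1 := log_le_entropyTerm hpos (card_le_mul J)
    have h2 : Real.log n ≤ Real.log (n * K : ℕ) :=
      Real.log_le_log (by positivity) (by exact_mod_cast Nat.le_mul_of_pos_right n hK)
    have h3 := mul_le_mul_of_nonneg_left (h2.trans h1) hβ₂.le
    unfold nonsepPenalty
    linarith

end Penalty

/-- This is where (A1) enters: members of an independent family are nonzero. -/
theorem part_supportSet_nonempty {n K : ℕ} {Z : Clustering n K} {L : Matrix (Fin n) (Fin K) ℝ}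
    (hL : LinIndepPopularities Z L) (k l : Fin K) : (part Z (supportSet L) k l).Nonempty := by
  have h := (hL k).ne_zero l
  obtain ⟨i, hi⟩ := Function.ne_iff.mp h
  exact ⟨i, by simpa [part, supportSet] using hi⟩

/-! ### Uniform control of the noise -/

section Noise

variable {n K : ℕ} {Ω : Type*} [MeasurableSpace Ω] {μ : Measure Ω} [IsProbabilityMeasure μ]
  {A : Ω → Matrix (Fin n) (Fin n) ℝ} {P : Matrix (Fin n) (Fin n) ℝ}

/-- The deviation level at which a union bound over all clusterings and test matrices holds. -/
def noiseLevel (n K d : ℕ) (t : ℝ) : ℝ := d * Real.log 25 + n * Real.log K + t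

theorem noiseLevel_nonneg (n K d : ℕ) {t : ℝ} (ht : 0 < t) : 0 ≤ noiseLevel n K d t := by
  have h1 : 0 ≤ Real.log 25 := Real.log_nonneg (by norm_num)
  have h2 : 0 ≤ Real.log (K : ℝ) := Real.log_natCast_nonneg K
  unfold noiseLevel
  positivity

theorem IsRandomAdjacency.union_tail (hA : IsRandomAdjacency μ A P) (hK : 0 < K) {t : ℝ}
    (ht : 0 < t) (d : Clustering n K → ℕ)
    (T : Clustering n K → Finset (Matrix (Fin n) (Fin n) ℝ))
    (hT : ∀ Z, (T Z).card ≤ 25 ^ d Z) (hT1 : ∀ Z, ∀ M ∈ T Z, frobSq M ≤ 1) :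
    μ.real {ω | ∃ Z, ∃ M ∈ T Z,
      √(noiseLevel n K (d Z) t) ≤ frobInner (A ω - meanMatrix μ A) M} ≤ Real.exp (-t) := by
  have hset : {ω | ∃ Z, ∃ M ∈ T Z,
      √(noiseLevel n K (d Z) t) ≤ frobInner (A ω - meanMatrix μ A) M} =
      ⋃ Z, ⋃ M ∈ T Z,
        {ω | √(noiseLevel n K (d Z) t) ≤ frobInner (A ω - meanMatrix μ A) M} := by
    ext ω; simp
  have hKn : (0 : ℝ) < (K : ℝ) ^ n := by positivity
  have hZ : ∀ Z : Clustering n K, μ.real (⋃ M ∈ T Z,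
      {ω | √(noiseLevel n K (d Z) t) ≤ frobInner (A ω - meanMatrix μ A) M}) ≤
      ((K : ℝ) ^ n)⁻¹ * Real.exp (-t) := by
    intro Z
    -- The three summands of the level pay for the test matrices, the clusterings and the
    -- confidence, respectively.
    have hexp : Real.exp (-√(noiseLevel n K (d Z) t) ^ 2) =
        ((25 : ℝ) ^ d Z)⁻¹ * (((K : ℝ) ^ n)⁻¹ * Real.exp (-t)) := by
      rw [Real.sq_sqrt (noiseLevel_nonneg _ _ _ ht), noiseLevel,
        show -(d Z * Real.log 25 + n * Real.log K + t) =
          -(d Z * Real.log 25) + (-(n * Real.log K) + -t) by ring,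
        Real.exp_add, Real.exp_add, Real.exp_neg, Real.exp_neg (n * Real.log K),
        Real.exp_nat_mul, Real.exp_nat_mul, Real.exp_log (by norm_num),
        Real.exp_log (by exact_mod_cast hK)]
    calc _ ≤ ∑ M ∈ T Z, μ.real
          {ω | √(noiseLevel n K (d Z) t) ≤ frobInner (A ω - meanMatrix μ A) M} :=
          measureReal_biUnion_finset_le _ _
      _ ≤ ∑ M ∈ T Z, Real.exp (-√(noiseLevel n K (d Z) t) ^ 2) :=
          Finset.sum_le_sum fun M hM => hA.tail (hT1 Z M hM) (Real.sqrt_nonneg _)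
      _ = (T Z).card * Real.exp (-√(noiseLevel n K (d Z) t) ^ 2) := by
          rw [Finset.sum_const, nsmul_eq_mul]
      _ ≤ (25 : ℝ) ^ d Z * Real.exp (-√(noiseLevel n K (d Z) t) ^ 2) := by
          gcongr
          exact_mod_cast hT Z
      _ = _ := by rw [hexp, mul_inv_cancel_left₀ (by positivity)]
  rw [hset]
  calc _ ≤ ∑ Z : Clustering n K, μ.real (⋃ M ∈ T Z,
        {ω | √(noiseLevel n K (d Z) t) ≤ frobInner (A ω - meanMatrix μ A) M}) :=
        measureReal_iUnion_fintype_le _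
    _ ≤ ∑ _Z : Clustering n K, ((K : ℝ) ^ n)⁻¹ * Real.exp (-t) :=
        Finset.sum_le_sum fun Z _ => hZ Z
    _ = Real.exp (-t) := by
        rw [Finset.sum_const, nsmul_eq_mul, Finset.card_univ]
        simp only [Fintype.card_fun, Fintype.card_fin, Nat.cast_pow]
        rw [mul_inv_cancel_left₀ hKn.ne']

theorem frobSq_smul {m n : Type*} [Fintype m] [Fintype n] (a : ℝ) (X : Matrix m n ℝ) :
    frobSq (a • X) = a ^ 2 * frobSq X := by
  simp only [frobSq, Matrix.smul_apply, smul_eq_mul, mul_pow, Finset.mul_sum]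

theorem frobInner_smul {m n : Type*} [Fintype m] [Fintype n] (a : ℝ) (X Y : Matrix m n ℝ) :
    frobInner X (a • Y) = a * frobInner X Y := by
  simp only [frobInner, Matrix.smul_apply, smul_eq_mul, Finset.mul_sum]
  exact Finset.sum_congr rfl fun i _ => Finset.sum_congr rfl fun j _ => by ring

theorem IsRandomAdjacency.linear_tail (hA : IsRandomAdjacency μ A P) {t : ℝ} (ht : 0 < t)
    (B : Matrix (Fin n) (Fin n) ℝ) :
    μ.real {ω | frobInner (A ω - meanMatrix μ A) B < -(√(frobSq B) * √t)} ≤ Real.exp (-t) := by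
  have hr := Real.sqrt_nonneg (frobSq B)
  -- The tail bound is applied to $-B/\|B\|_F$. For $B=0$ this is the zero matrix, and the strict
  -- inequality defining the event fails.
  have hM : frobSq ((-(√(frobSq B))⁻¹) • B) ≤ 1 := by
    rw [frobSq_smul, neg_sq, inv_pow, Real.sq_sqrt (frobSq_nonneg B)]
    exact inv_mul_le_one
  have htail := hA.tail hM (Real.sqrt_nonneg t)
  rw [Real.sq_sqrt ht.le] at htail
  refine (measureReal_mono fun ω hω => ?_).trans htail
  change frobInner (A ω - meanMatrix μ A) B < -(√(frobSq B) * √t) at hω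
  change √t ≤ _
  rw [frobInner_smul]
  rcases hr.eq_or_lt with h0 | hpos
  · have hB : frobSq B = 0 := (Real.sqrt_eq_zero (frobSq_nonneg B)).mp h0.symm
    have hB0 : ∀ i j, B i j = 0 := by
      intro i j
      have h1 := (Finset.sum_eq_zero_iff_of_nonneg fun i _ =>
        Finset.sum_nonneg fun j _ => sq_nonneg (B i j)).mp hB i (Finset.mem_univ i)
      have h2 := (Finset.sum_eq_zero_iff_of_nonneg fun j _ => sq_nonneg (B i j)).mp h1 j
        (Finset.mem_univ j)
      exact pow_eq_zero_iff two_ne_zero |>.mp h2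
    simp [frobInner, hB0, ← h0] at hω
  · have h1 : √(frobSq B) * √t ≤ -frobInner (A ω - meanMatrix μ A) B := by linarith
    rw [neg_mul, ← mul_neg, le_inv_mul_iff₀ hpos]
    exact h1

end Noise

/-! ### The criterion -/

section Criterion

variable {n K : ℕ}

theorem frobSq_sub_opSq_add_le_criterion (pen : Clustering n K → Finset (Fin n × Fin K) → ℝ)
    (A : Matrix (Fin n) (Fin n) ℝ) (Z : Clustering n K) (J : Finset (Fin n × Fin K)) :
    frobSq A - opSq Z A + pen Z J ≤ criterion pen A Z J := by
  unfold criterion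
  gcongr
  rw [← sum_frobSq_block Z A, opSq, ← Finset.sum_sub_distrib]
  refine Finset.sum_le_sum fun k _ => ?_
  rw [← Finset.sum_sub_distrib]
  exact Finset.sum_le_sum fun l _ => frobSq_sub_opNorm_sq_le _ (rankOneApprox_spec _).1

theorem criterion_le {pen : Clustering n K → Finset (Fin n × Fin K) → ℝ}
    {A : Matrix (Fin n) (Fin n) ℝ} {Z : Clustering n K} {L : Matrix (Fin n) (Fin K) ℝ}
    (hA : ∀ i j, probMatrix Z L i j = 0 → A i j = 0) :
    criterion pen A Z (supportSet L) ≤ frobSq (A - probMatrix Z L) + pen Z (supportSet L) := by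
  unfold criterion
  gcongr
  rw [← sum_frobSq_block Z (A - probMatrix Z L)]
  refine Finset.sum_le_sum fun k _ => Finset.sum_le_sum fun l _ => ?_
  have hproj : rectProj (part Z (supportSet L) k l) (part Z (supportSet L) l k) (block Z A k l) =
      block Z A k l := by
    ext ⟨i, rfl⟩ ⟨j, rfl⟩
    simp only [rectProj, Matrix.of_apply, ite_eq_left_iff]
    intro h
    symm
    refine hA i j ?_
    by_contra hne
    have hne' : L i (Z j) * L j (Z i) ≠ 0 := hne
    exact h (by simpa [part, supportSet] using hne')
  rw [hproj]
  refine (rankOneApprox_spec (block Z A k l)).2 (block Z (probMatrix Z L) k l) ?_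
  rw [rank_le_one_iff_minors]
  rintro ⟨i, rfl⟩ ⟨i', hi'⟩ ⟨j, rfl⟩ ⟨j', hj'⟩
  simp only [block, Matrix.submatrix_apply, probMatrix, Matrix.of_apply, hi', hj']
  ring

variable {Z : Clustering n K} {L : Matrix (Fin n) (Fin K) ℝ}

theorem probMatrix_symm (Z : Clustering n K) (L : Matrix (Fin n) (Fin K) ℝ) (i j : Fin n) :
    probMatrix Z L i j = probMatrix Z L j i := mul_comm _ _

/-- A function of the positions that lives on the diagonal entries with nonzero probability and is
bounded by one there has a sum of at most the number of nonzero popularities. -/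
theorem sum_sum_le_card_supportSet {f : Fin n → Fin n → ℝ}
    (hoff : ∀ i j, i ≠ j → f i j ≤ 0) (hdiag : ∀ i, f i i ≤ 1)
    (hzero : ∀ i, L i (Z i) = 0 → f i i ≤ 0) : ∑ i, ∑ j, f i j ≤ (supportSet L).card := by
  classical
  let D : Finset (Fin n) := Finset.univ.filter fun i => L i (Z i) ≠ 0
  have h1 : ∑ i, ∑ j, f i j ≤ ∑ i, if i ∈ D then (1 : ℝ) else 0 := by
    refine Finset.sum_le_sum fun i _ => ?_
    have h2 : ∑ j, f i j ≤ f i i := by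
      rw [← Finset.add_sum_erase _ _ (Finset.mem_univ i)]
      have := Finset.sum_nonpos (s := Finset.univ.erase i) (f := f i) fun j hj =>
        hoff i j (Finset.ne_of_mem_erase hj).symm
      linarith
    refine h2.trans ?_
    split_ifs with h
    · exact hdiag i
    · exact hzero i (by simpa [D] using h)
  have h3 : D.card ≤ (supportSet L).card := by
    refine Finset.card_le_card_of_injOn (fun i => (i, Z i)) ?_ ?_
    · intro i hi
      have : L i (Z i) ≠ 0 := by simpa [D] using hi
      simpa [supportSet] using this
    · intro i _ j _ hij
      exact (Prod.ext_iff.mp hij).1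
  refine h1.trans ?_
  rw [Finset.sum_ite_mem, Finset.univ_inter, Finset.sum_const, nsmul_eq_mul, mul_one]
  exact_mod_cast h3

variable {m : Matrix (Fin n) (Fin n) ℝ}

/-- Without self-loops the mean differs from $P_*$ only on the diagonal. Each nonzero
$\Lambda_{i,c(i)}^2\le1$ there is charged to the position $(i,c(i))$ of $J_*$. -/
theorem frobSq_mean_sub_le (hL : ∀ i l, L i l ∈ Set.Icc (0 : ℝ) 1)
    (hoff : ∀ i j, i ≠ j → m i j = probMatrix Z L i j)
    (hdiag : ∀ i, m i i = probMatrix Z L i i ∨ m i i = 0) :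
    frobSq (m - probMatrix Z L) ≤ (supportSet L).card := by
  refine sum_sum_le_card_supportSet (Z := Z) (fun i j hij => ?_) (fun i => ?_) fun i hi => ?_
  · rw [Matrix.sub_apply, hoff i j hij]; simp
  · have h := hL i (Z i)
    rcases hdiag i with h' | h'
    · rw [Matrix.sub_apply, h']; simp
    · rw [Matrix.sub_apply, h', zero_sub, neg_sq]
      exact pow_le_one₀ (mul_nonneg h.1 h.1) (mul_le_one₀ h.2 h.1 h.2)
  · rcases hdiag i with h' | h' <;>
      simp [h', probMatrix, hi]

theorem frobSq_le_frobInner_mean_add (hL : ∀ i l, L i l ∈ Set.Icc (0 : ℝ) 1)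
    (hoff : ∀ i j, i ≠ j → m i j = probMatrix Z L i j)
    (hdiag : ∀ i, m i i = probMatrix Z L i i ∨ m i i = 0) :
    frobSq (probMatrix Z L) ≤ frobInner m (probMatrix Z L) + (supportSet L).card := by
  have key : ∑ i, ∑ j, (probMatrix Z L i j ^ 2 - m i j * probMatrix Z L i j) ≤
      (supportSet L).card := by
    refine sum_sum_le_card_supportSet (Z := Z) (fun i j hij => ?_) (fun i => ?_) fun i hi => ?_
    · rw [hoff i j hij]; exact le_of_eq (by ring)
    · have h := hL i (Z i)
      rcases hdiag i with h' | h'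
      · rw [h']; exact le_trans (le_of_eq (by ring)) zero_le_one
      · rw [h', zero_mul, sub_zero]
        exact pow_le_one₀ (mul_nonneg h.1 h.1) (mul_le_one₀ h.2 h.1 h.2)
    · simp [probMatrix, hi]
  simp only [Finset.sum_sub_distrib] at key
  have h1 : frobSq (probMatrix Z L) = ∑ i, ∑ j, probMatrix Z L i j ^ 2 := rfl
  have h2 : frobInner m (probMatrix Z L) = ∑ i, ∑ j, m i j * probMatrix Z L i j := rfl
  linarith

end Criterion

/-! ### Consistency of the clustering -/

/-- The numerical constants in the comparison of the true and the estimated clustering. -/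
theorem separation_contradiction {α F O h J N t H b X R Q : ℝ} (hα : α ∈ Set.Ioo (0 : ℝ) (1 / 2))
    (hO : 0 ≤ O) (hh : 0 ≤ h) (hJ : 0 ≤ J) (hN : 0 ≤ N) (ht : 0 < t) (hH : 0 ≤ H) (hb : 0 < b)
    (hF : 0 ≤ F)
    (hX : X ≤ (1 + α / 4) * O + (1 + 1 / (α / 4)) * R)
    (hR : R ≤ (1 + 1) * Q + (1 + 1 / 1) * J)
    (hQ : Q ≤ 64 * (h + N + t))
    (hcomp : F - 2 * (√F * √t) - 2 * J ≤ X + b * H)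
    (hsep : ((1 + α) * O + 1000 / α * h) + 1000 / α * (J + N + t) + 2 * b * H ≤ F) : False := by
  obtain ⟨hα0, hα1⟩ := hα
  -- The weight $\alpha/4$ leaves $(1-\alpha/4)F$, and $(1-\alpha/4)(1+\alpha)\ge1+\alpha/4$ keeps
  -- the operator term dominated.
  have hcross : 2 * (√F * √t) ≤ α / 4 * F + 4 / α * t := by
    have h0 : 0 ≤ (α * √F - 4 * √t) ^ 2 / (4 * α) := by positivity
    have h1 : (α * √F - 4 * √t) ^ 2 / (4 * α) =
        α / 4 * √F ^ 2 - 2 * (√F * √t) + 4 / α * √t ^ 2 := by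
      field_simp; ring
    rw [h1, Real.sq_sqrt hF, Real.sq_sqrt ht.le] at h0
    linarith
  have hR' : R ≤ 128 * (h + N + t) + 2 * J := by linarith
  have hRpos : 0 ≤ 128 * (h + N + t) + 2 * J := by positivity
  have hcoef : 1 + 1 / (α / 4) ≤ 5 / α := by
    rw [show 1 + 1 / (α / 4) = (α + 4) / α by field_simp]
    gcongr; linarith
  have hX' : X ≤ (1 + α / 4) * O + 5 / α * (128 * (h + N + t) + 2 * J) := by
    have h1 : (1 + 1 / (α / 4)) * R ≤ (1 + 1 / (α / 4)) * (128 * (h + N + t) + 2 * J) :=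
      mul_le_mul_of_nonneg_left hR' (by positivity)
    have h2 := mul_le_mul_of_nonneg_right hcoef hRpos
    linarith
  have hmain : (1 - α / 4) * F ≤ (1 + α / 4) * O + 5 / α * (128 * (h + N + t) + 2 * J)
      + 4 / α * t + 2 * J + b * H := by linarith
  have hsep' := mul_le_mul_of_nonneg_left hsep (show 0 ≤ 1 - α / 4 by linarith)
  have hOO : (1 + α / 4) * O ≤ (1 - α / 4) * ((1 + α) * O) := by nlinarith [mul_nonneg hα0.le hO]
  have hHH : b * H ≤ (1 - α / 4) * (2 * b * H) := by nlinarith [mul_nonneg hb.le hH]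
  have hinv : 0 < 1 / α := by positivity
  have hinv1 : 1 ≤ 1 / α := by rw [le_div_iff₀ hα0]; linarith
  -- As $\alpha/4<1/8$, at least $875$ of the $1000$ remains, against a need of at most $644$ ($640$
  -- from the noise and $4$ from the cross term). Strictness comes from $t>0$.
  have hS : 875 * (1 / α * (h + J + N + t)) ≤
      (1 - α / 4) * (1000 / α * h + 1000 / α * (J + N + t)) := by
    have h1 : 0 ≤ 1 / α * (h + J + N + t) := by positivity
    have h2 : 1000 / α * h + 1000 / α * (J + N + t) = 1000 * (1 / α * (h + J + N + t)) := by ring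
    rw [h2]
    nlinarith
  have hJJ : 2 * J ≤ 2 * (1 / α * J) := by nlinarith
  have h5 : 5 / α * (128 * (h + N + t) + 2 * J) =
      640 * (1 / α * (h + N + t)) + 10 * (1 / α * J) := by ring
  have h4 : 4 / α * t = 4 * (1 / α * t) := by ring
  have p1 : 0 ≤ 1 / α * h := by positivity
  have p2 : 0 ≤ 1 / α * J := by positivity
  have p3 : 0 ≤ 1 / α * N := by positivity
  have p4 : 0 < 1 / α * t := by positivity
  rw [h5, h4] at hmain
  linarith

theorem log_twentyFive_le : Real.log 25 ≤ 4 := by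
  have h : (25 : ℝ) = 5 ^ 2 := by norm_num
  rw [h, Real.log_pow]
  have h5 : Real.log 5 ≤ 2 := by
    rw [Real.log_le_iff_le_exp (by norm_num), show (2 : ℝ) = 1 + 1 by norm_num, Real.exp_add]
    nlinarith [Real.exp_one_gt_d9]
  push_cast
  linarith

theorem misclustered_le_of_noise_bounds {β₁ β₂ : ℝ} (hβ₁ : 0 < β₁) (hβ₂ : 0 < β₂) {n K : ℕ}
    (hK : 0 < K) {Zstar : Clustering n K} {L : Matrix (Fin n) (Fin K) ℝ}
    (hL : ∀ i l, L i l ∈ Set.Icc (0 : ℝ) 1) (hind : LinIndepPopularities Zstar L)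
    {A m : Matrix (Fin n) (Fin n) ℝ}
    (hoff : ∀ i j, i ≠ j → m i j = probMatrix Zstar L i j)
    (hdiag : ∀ i, m i i = probMatrix Zstar L i i ∨ m i i = 0)
    (hA : ∀ i j, probMatrix Zstar L i j = 0 → A i j = 0)
    {pen : Clustering n K → Finset (Fin n × Fin K) → ℝ}
    (hpen : pen = sepPenalty β₁ β₂ ∨ pen = nonsepPenalty β₁ β₂)
    {α δ t : ℝ} (hα : α ∈ Set.Ioo (0 : ℝ) (1 / 2)) (ht : 0 < t)
    (hsep : SeparationCondition 1000 (2 * (β₁ + 2 * β₂)) α δ t Zstar L)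
    {Zhat : Clustering n K} {Jhat : Finset (Fin n × Fin K)} (hsol : IsSolution pen A Zhat Jhat)
    (hnoise : opSq Zhat (A - m) ≤
      16 * noiseLevel n K (blockSupport Zhat (probMatrix Zstar L)).card t)
    (hlin : -(√(frobSq (probMatrix Zstar L)) * √t) ≤ frobInner (A - m) (probMatrix Zstar L)) :
    misclustered Zhat Zstar ≤ δ := by
  by_contra! hfar
  set P := probMatrix Zstar L
  have hcrit := (frobSq_sub_opSq_add_le_criterion pen A Zhat Jhat).trans
    ((hsol Zstar (supportSet L)).trans (criterion_le hA))
  rw [frobSq_sub] at hcrit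
  have hpen1 := penBase_le_of_penalty Zhat Jhat hβ₁ hβ₂ hpen
  have hpen2 := penalty_le Zstar (supportSet L) hβ₁ hβ₂ hK
    (part_supportSet_nonempty hind) hpen
  have hmean := frobSq_le_frobInner_mean_add hL hoff hdiag
  have hbias := frobSq_mean_sub_le hL hoff hdiag
  have hinner : frobInner (A - m) P = frobInner A P - frobInner m P := by
    simp only [frobInner, Matrix.sub_apply, sub_mul, Finset.sum_sub_distrib]
  have hX := opSq_add_le Zhat P ((A - m) + (m - P)) (ε := α / 4) (by linarith [hα.1])
  rw [show P + ((A - m) + (m - P)) = A by abel] at hX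
  have hR := opSq_add_le Zhat (A - m) (m - P) one_pos
  have hR' : opSq Zhat ((A - m) + (m - P)) ≤
      (1 + 1) * opSq Zhat (A - m) + (1 + 1 / 1) * (supportSet L).card := by
    have := (opSq_le_frobSq Zhat (m - P)).trans hbias
    linarith
  have hh := le_entropyTerm (card_le_mul (blockSupport Zhat P))
  have hlogK : 0 ≤ n * Real.log K := mul_nonneg n.cast_nonneg (Real.log_natCast_nonneg K)
  have hQ : opSq Zhat (A - m) ≤
      64 * (entropyTerm (n * K) (blockSupport Zhat P).card + n * Real.log K + t) := by
    have h1 : ((blockSupport Zhat P).card : ℝ) * Real.log 25 ≤ (blockSupport Zhat P).card * 4 :=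
      mul_le_mul_of_nonneg_left log_twentyFive_le (Nat.cast_nonneg _)
    unfold noiseLevel at hnoise
    linarith
  refine separation_contradiction hα (opSq_nonneg Zhat P)
    (entropyTerm_nonneg (card_le_mul (blockSupport Zhat P))) (Nat.cast_nonneg _) hlogK ht
    (entropyTerm_nonneg (card_le_mul (supportSet L))) (show 0 < β₁ + 2 * β₂ by linarith)
    (frobSq_nonneg P) hX hR' hQ ?_ (hsep Zhat hfar.le)
  rw [hinner] at hlin
  linarith

end PABM

end

/-! ### Assembly: two exceptional events of probability at most $e^{-t}$ each, and a null set. -/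

theorem theorem2 (β₁ β₂ : ℝ) (hβ₁ : 0 < β₁) (hβ₂ : 0 < β₂) :
    ∃ H₁ H₂ : ℝ, 0 < H₁ ∧ 0 < H₂ ∧
      ∀ (n K : ℕ), 2 ≤ K →
      ∀ (Zstar : PABM.Clustering n K) (L : Matrix (Fin n) (Fin K) ℝ),
        (∀ i l, L i l ∈ Set.Icc (0 : ℝ) 1) →
        PABM.LinIndepPopularities Zstar L →
      ∀ (Ω : Type*) [MeasurableSpace Ω] (μ : Measure Ω) [IsProbabilityMeasure μ]
        (A : Ω → Matrix (Fin n) (Fin n) ℝ),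
        PABM.IsRandomAdjacency μ A (PABM.probMatrix Zstar L) →
      ∀ pen : PABM.Clustering n K → Finset (Fin n × Fin K) → ℝ,
        pen = PABM.sepPenalty β₁ β₂ ∨ pen = PABM.nonsepPenalty β₁ β₂ →
      ∀ α ∈ Set.Ioo (0 : ℝ) (1 / 2), ∀ δ ∈ Set.Ioo (0 : ℝ) 1, ∀ t : ℝ, 0 < t →
        PABM.SeparationCondition H₁ H₂ α δ t Zstar L →
        1 - 2 * Real.exp (-t) ≤
          μ.real {ω | ∀ Zhat Jhat, PABM.IsSolution pen (A ω) Zhat Jhat →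
            PABM.misclustered Zhat Zstar ≤ δ} := by
  refine ⟨1000, 2 * (β₁ + 2 * β₂), by norm_num, by positivity, ?_⟩
  intro n K hK Zstar L hL hind Ω _ μ _ A hA pen hpen α hα δ _ t ht hsep
  have hK0 : 0 < K := by omega
  let P := PABM.probMatrix Zstar L
  have hPs : ∀ i j, P i j = P j i := PABM.probMatrix_symm Zstar L
  let m := PABM.meanMatrix μ A
  have hoff : ∀ i j, i ≠ j → m i j = P i j := fun i j hij => hA.mean_offDiag hPs hij
  have hdiag : ∀ i, m i i = P i i ∨ m i i = 0 := hA.mean_diag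
  choose T hT hT1 hT2 using fun Z : PABM.Clustering n K =>
    PABM.exists_test_matrices Z (PABM.blockSupport Z P)
  let bad₁ : Set Ω := {ω | ∃ Z, ∃ M ∈ T Z,
    √(PABM.noiseLevel n K (PABM.blockSupport Z P).card t) ≤ PABM.frobInner (A ω - m) M}
  let bad₂ : Set Ω := {ω | PABM.frobInner (A ω - m) P < -(√(PABM.frobSq P) * √t)}
  let null : Set Ω := {ω | ¬∀ i j, P i j = 0 → A ω i j = 0}
  let good : Set Ω := {ω | ∀ Zhat Jhat, PABM.IsSolution pen (A ω) Zhat Jhat →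
    PABM.misclustered Zhat Zstar ≤ δ}
  have h₁ : μ.real bad₁ ≤ Real.exp (-t) := hA.union_tail hK0 ht _ T hT hT1
  have h₂ : μ.real bad₂ ≤ Real.exp (-t) := hA.linear_tail ht P
  have h₀ : μ.real null = 0 := by
    rw [measureReal_eq_zero_iff]
    exact ae_iff.mp (hA.ae_eq_zero hPs)
  have hcover : (Set.univ : Set Ω) ⊆ good ∪ (null ∪ (bad₁ ∪ bad₂)) := by
    intro ω _
    by_cases hω : ω ∈ null ∪ (bad₁ ∪ bad₂)
    · exact Or.inr hω
    · left
      simp only [Set.mem_union, not_or] at hω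
      obtain ⟨hn, hb₁, hb₂⟩ := hω
      have hA0 : ∀ i j, P i j = 0 → A ω i j = 0 := not_not.mp hn
      have hb₁' : ∀ Z, ∀ M ∈ T Z, PABM.frobInner (A ω - m) M ≤
          √(PABM.noiseLevel n K (PABM.blockSupport Z P).card t) := by
        intro Z M hM
        by_contra! h
        exact hb₁ ⟨Z, M, hM, h.le⟩
      -- Outside the null set the noise vanishes with $P_*$, so the nets for $\breve J_*(Z)$ apply.
      have hsupp : ∀ i j, (A ω - m) i j ≠ 0 → P i j ≠ 0 := by
        intro i j h h0
        apply h
        have hm : m i j = 0 := by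
          by_cases hij : i = j
          · subst hij
            rcases hdiag i with h' | h'
            exacts [h'.trans h0, h']
          · exact (hoff i j hij).trans h0
        rw [Matrix.sub_apply, hA0 i j h0, hm, sub_zero]
      intro Zhat Jhat hsol
      refine PABM.misclustered_le_of_noise_bounds hβ₁ hβ₂ hK0 hL hind hoff hdiag hA0 hpen hα ht
        hsep hsol ?_ (not_lt.mp hb₂)
      have h := hT2 Zhat (A ω - m) _ (fun i j h => ?_) (hb₁' Zhat)
      · rwa [Real.sq_sqrt (PABM.noiseLevel_nonneg _ _ _ ht)] at h
      · have hP := hsupp i j h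
        have hP' : P j i ≠ 0 := by rwa [← hPs]
        exact ⟨by simpa [PABM.blockSupport] using ⟨j, rfl, hP⟩,
          by simpa [PABM.blockSupport] using ⟨i, rfl, hP'⟩⟩
  have h1 : (1 : ℝ) ≤ μ.real (good ∪ (null ∪ (bad₁ ∪ bad₂))) := by
    rw [← probReal_univ (μ := μ)]
    exact measureReal_mono hcover
  have h2 := measureReal_union_le (μ := μ) good (null ∪ (bad₁ ∪ bad₂))
  have h3 := measureReal_union_le (μ := μ) null (bad₁ ∪ bad₂)
  have h4 := measureReal_union_le (μ := μ) bad₁ bad₂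
  change 1 - 2 * Real.exp (-t) ≤ μ.real good
  linarith
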